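/- Let $G$ be a group acting by isometries on a Gromov hyperbolic geodesic metric space $X$, and fix a basepoint $x\in X$. Definitions. For $Y\subseteq X$, the action is *acylindrical along $Y$* if for every $\varepsilon\ge 0$ there are $R>0$ and $M>0$ such that for all $y,z\in Y$ with $d(y,z)\ge R$, $$\#\{g\in G\mid d(gy,y)\le\varepsilon\text{ and }d(gz,z)\le\varepsilon\}\le M .$$ For a subgroup $H\le G$, the action is *acylindrical along $H$* if it is acylindrical along some orbit $Hy$, $y\in X$. The triple $(G,X,H)$ is an *A/QI triple* if $H$ is finitely generated and infinite, the action is acylindrical along $H$, and for some $y\in X$ the orbit map $H\to X$, $h\mapsto hy$, is a quasi-isometric embedding, where $H$ carries the word metric of a finite generating set. The *limit set* $\Lambda(H)\subseteq\partial X$ is the set of those points of the Gromov boundary that are limits of sequences $(h_nx)$ with $h_n\in H$. A finitely generated subgroup $K$ of a finitely generated group $H$ is *quasi-isometrically embedded* in $H$ if the inclusion $K\to H$ is a quasi-isometric embedding for word metrics of finite generating sets. Theorem. Let $H_1,\dots,H_k$ be subgroups of $G$ such that $(G,X,H_i)$ is an A/QI triple for each $i=1,\dots,k$ and $\Lambda(H_i)\cap\Lambda(H_j)=\emptyset$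 for all $i\ne j$. Then there is a finite set $\mathcal S\subset\bigcup_{i=1}^k H_i\setminus\{1\}$ with the following property. Let $K_i\le H_i$ $(i=1,\dots,k)$ be quasi-isometrically embedded subgroups with $K_i\cap\mathcal S=\emptyset$ for every $i$, and let $K=\langle K_1,\dots,K_k\rangle$. Then the canonical homomorphism $K_1*\cdots*K_k\to K$ is an isomorphism. Moreover, if some $K_i$ is infinite or at least two of the $K_i$ are non-trivial (equivalently, if $K$ is infinite), then $(G,X,K)$ is an A/QI triple. -/

import Mathlib

open Filter

namespace AQI

section Hyperbolic

/-- A geodesic metric space: any two points are joined by an isometrically embedded interval. -/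
class IsGeodesicSpace (X : Type*) [MetricSpace X] : Prop where
  exists_geodesic : ∀ x y : X, ∃ γ : ℝ → X, γ 0 = x ∧ γ (dist x y) = y ∧
    ∀ s ∈ Set.Icc (0 : ℝ) (dist x y), ∀ t ∈ Set.Icc (0 : ℝ) (dist x y),
      dist (γ s) (γ t) = |s - t|

/-- The Gromov product `(x | y)_o`. -/
noncomputable def gromovProduct {X : Type*} [MetricSpace X] (o x y : X) : ℝ :=
  (dist o x + dist o y - dist x y) / 2

/-- Gromov hyperbolicity: there is `δ ≥ 0` such that
`(x | z)_o ≥ min ((x | y)_o, (y | z)_o) - δ` for all points `o, x, y, z`. -/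
class IsGromovHyperbolic (X : Type*) [MetricSpace X] : Prop where
  exists_delta : ∃ δ : ℝ, 0 ≤ δ ∧ ∀ o x y z : X,
    min (gromovProduct o x y) (gromovProduct o y z) - δ ≤ gromovProduct o x z

/-- A sequence `u` converges to infinity if `(u m | u n)_o → ∞` as `m, n → ∞`. The condition does
not depend on `o`, so that it may be asked for all `o` at once. -/
def ConvergesToInfinity {X : Type*} [MetricSpace X] (u : ℕ → X) : Prop :=
  ∀ o : X, Tendsto (fun p : ℕ × ℕ => gromovProduct o (u p.1) (u p.2)) atTop atTop

/-- Two sequences `u`, `v` converging to infinity are equivalent if `(u n | v n)_o → ∞`. -/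
def AsymptoticSeq {X : Type*} [MetricSpace X] (u v : ℕ → X) : Prop :=
  ∀ o : X, Tendsto (fun n : ℕ => gromovProduct o (u n) (v n)) atTop atTop

theorem gromovProduct_comm {X : Type*} [MetricSpace X] (o x y : X) :
    gromovProduct o x y = gromovProduct o y x := by
  unfold gromovProduct
  rw [dist_comm x y]
  ring

/-- Equivalence of sequences converging to infinity in a hyperbolic space. -/
def boundarySetoid (X : Type*) [MetricSpace X] [IsGromovHyperbolic X] :
    Setoid {u : ℕ → X // ConvergesToInfinity u} where
  r u v := AsymptoticSeq u.1 v.1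
  iseqv := by
    refine ⟨fun u o => ?_, fun {u v} h o => ?_, fun {u v w} h h' o => ?_⟩
    · have hd : Tendsto (fun n : ℕ => (n, n)) atTop atTop :=
        tendsto_atTop_atTop.2 fun b => ⟨max b.1 b.2, fun a ha =>
          ⟨le_trans (le_max_left _ _) ha, le_trans (le_max_right _ _) ha⟩⟩
      exact (u.2 o).comp hd
    · simpa only [gromovProduct_comm] using h o
    · obtain ⟨δ, -, hδ⟩ := IsGromovHyperbolic.exists_delta (X := X)
      rw [tendsto_atTop]
      intro b
      filter_upwards [(tendsto_atTop.1 (h o)) (b + δ), (tendsto_atTop.1 (h' o)) (b + δ)]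
        with n h1 h2
      have h3 := hδ o (u.1 n) (v.1 n) (w.1 n)
      have h4 := le_min h1 h2
      linarith

/-- The Gromov boundary `∂X`: equivalence classes of sequences converging to infinity. -/
def GromovBoundary (X : Type*) [MetricSpace X] [IsGromovHyperbolic X] : Type _ :=
  Quotient (boundarySetoid X)

/-- The sequence `u` of points of `X` converges to the boundary point `p`, that is, it converges to
infinity and its class is `p`. -/
def TendstoBoundary {X : Type*} [MetricSpace X] [IsGromovHyperbolic X]
    (u : ℕ → X) (p : GromovBoundary X) : Prop :=
  ∃ hu : ConvergesToInfinity u, Quotient.mk (boundarySetoid X) ⟨u, hu⟩ = p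

/-- The limit set `Λ(H) ⊆ ∂X` of a subgroup, with respect to the basepoint `x`. -/
def limitSet {G X : Type*} [Group G] [MetricSpace X] [IsGromovHyperbolic X] [MulAction G X]
    (x : X) (H : Subgroup G) : Set (GromovBoundary X) :=
  {p | ∃ h : ℕ → G, (∀ n, h n ∈ H) ∧ TendstoBoundary (fun n => h n • x) p}

end Hyperbolic

section WordMetric

/-- The word length of `a` with respect to `S`: the least length of a word in `S ∪ S⁻¹` that
represents `a` (used only when `S` generates the group). -/
noncomputable def wordLength {A : Type*} [Group A] (S : Set A) (a : A) : ℕ :=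
  sInf {n | ∃ l : List A, l.length = n ∧ (∀ s ∈ l, s ∈ S ∨ s⁻¹ ∈ S) ∧ l.prod = a}

/-- The word metric. -/
noncomputable def wordDist {A : Type*} [Group A] (S : Set A) (a b : A) : ℝ :=
  (wordLength S (a⁻¹ * b) : ℝ)

/-- `S` is a finite generating set of `A`. -/
def IsFiniteGeneratingSet {A : Type*} [Group A] (S : Set A) : Prop :=
  S.Finite ∧ Subgroup.closure S = ⊤

/-- `f` is a `τ`-quasi-isometric embedding with respect to the distance functions `dA`, `dB`. -/
def IsQIEmbedding {A B : Type*} (dA : A → A → ℝ) (dB : B → B → ℝ) (τ : ℝ) (f : A → B) : Prop :=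
  ∀ a b : A, τ⁻¹ * dA a b - τ ≤ dB (f a) (f b) ∧ dB (f a) (f b) ≤ τ * dA a b + τ

/-- `K ≤ H` is a (finitely generated) quasi-isometrically embedded subgroup of the finitely
generated group `H`: the inclusion is a quasi-isometric embedding for the word metrics of finite
generating sets. This does not depend on the generating sets. -/
def IsQIEmbeddedSubgroup {G : Type*} [Group G] {K H : Subgroup G} (hKH : K ≤ H) : Prop :=
  ∃ (S : Set K) (T : Set H), IsFiniteGeneratingSet S ∧ IsFiniteGeneratingSet T ∧
    ∃ τ : ℝ, 1 ≤ τ ∧ IsQIEmbedding (wordDist S) (wordDist T) τ (Subgroup.inclusion hKH)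

end WordMetric

section Action

/-- The action of `G` on `X` is acylindrical along the subset `Y`. -/
def IsAcylindricalAlongSet (G : Type*) {X : Type*} [Group G] [MetricSpace X] [MulAction G X]
    (Y : Set X) : Prop :=
  ∀ ε : ℝ, 0 ≤ ε → ∃ R : ℝ, 0 < R ∧ ∃ M : ℕ, 0 < M ∧ ∀ x ∈ Y, ∀ y ∈ Y, R ≤ dist x y →
    {g : G | dist (g • x) x ≤ ε ∧ dist (g • y) y ≤ ε}.encard ≤ (M : ℕ∞)

/-- The action of `G` on `X` is acylindrical along the subgroup `H`: it is acylindrical along the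
orbit `Hx` for some `x`. -/
def IsAcylindricalAlong {G : Type*} (X : Type*) [Group G] [MetricSpace X] [MulAction G X]
    (H : Subgroup G) : Prop :=
  ∃ x : X, IsAcylindricalAlongSet G {y : X | ∃ h ∈ H, h • x = y}

/-- The subgroup `H` is finitely generated and quasi-isometrically embedded by the action: for some
`x`, the orbit map `h ↦ hx` is a quasi-isometric embedding of `H`, with the word metric of a finite
generating set, into `X`. -/
def IsQIEmbeddedByAction {G : Type*} (X : Type*) [Group G] [MetricSpace X] [MulAction G X]
    (H : Subgroup G) : Prop :=
  ∃ S : Set H, IsFiniteGeneratingSet S ∧ ∃ x : X, ∃ τ : ℝ, 1 ≤ τ ∧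
    IsQIEmbedding (wordDist S) dist τ (fun h : H => (h : G) • x)

/-- `(G, X, H)` is an A/QI triple. -/
structure IsAQITriple (G X : Type*) [Group G] [MetricSpace X] [IsGeodesicSpace X]
    [IsGromovHyperbolic X] [MulAction G X] [IsIsometricSMul G X] (H : Subgroup G) : Prop where
  infinite : Infinite H
  qiEmbedded : IsQIEmbeddedByAction X H
  acylindrical : IsAcylindricalAlong X H

end Action

end AQI

/-! Bounded products. A quasi-isometrically embedded orbit is made of quasigeodesics, so by the
Morse lemma and the finiteness of balls in `H i`, its far points fall into finitely many classes of
large mutual Gromov product. By pigeonhole, unbounded products between the orbits of `H i` and `H j`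
would give a common limit point. Disjoint limit sets therefore give one constant `C` bounding all
these products (`exists_gromovProduct_le_of_disjoint_limitSet`).

Free product and quasi-isometry. Excluding the finitely many nontrivial elements of small
displacement makes every nontrivial letter move `x` by more than a large `L`. The prefixes of a
reduced word then trace a broken path in `X` with long edges and corner products at most `C`. In a
hyperbolic space such a path makes definite progress: each edge adds at least half its length to the
distance from `x`. Nonempty reduced words are thus nontrivial, and displacement controls word
length.

Acylindricity. An element moving both ends of such a path by at most `ε` moves every vertex by at
most `ε` plus a constant. If some edge is long in terms of `ε`, acylindricity along one `H i` bounds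
the number of these elements. Otherwise all edges are short in terms of `ε`, and `L`, fixed before
`ε`, cannot help directly. But the elements fall into boundedly many classes according to how they
shift a middle edge along the path, and the quotient of two elements of one class moves that edge by
an amount independent of `ε` (`FourPoint.encard_movers_le`). Acylindricity for this single
displacement, built into `L`, finishes the count. -/

namespace AQI

/-! ### Gromov products and the Morse lemma -/

section Metric

variable {X : Type*} [MetricSpace X]

theorem gromovProduct_le_dist_left (o x y : X) : gromovProduct o x y ≤ dist o x := by
  unfold gromovProduct
  linarith [dist_triangle o x y]

theorem gromovProduct_le_dist_right (o x y : X) : gromovProduct o x y ≤ dist o y := by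
  rw [gromovProduct_comm]
  exact gromovProduct_le_dist_left o y x

theorem dist_sub_dist_le_gromovProduct (o x y : X) :
    dist o x - dist x y ≤ gromovProduct o x y := by
  unfold gromovProduct
  linarith [dist_triangle o y x, dist_comm x y]

theorem gromovProduct_add_gromovProduct (o x y : X) :
    gromovProduct o x y + gromovProduct x o y = dist o x := by
  unfold gromovProduct
  rw [dist_comm x o]
  ring

theorem gromovProduct_le_dist_of_between {a b q : X} (p : X)
    (h : dist a q + dist q b = dist a b) : gromovProduct p a b ≤ dist p q := by
  unfold gromovProduct
  linarith [dist_triangle p q a, dist_triangle p q b, dist_comm a q]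

/-- The four-point inequality with constant `δ`. -/
def FourPoint (X : Type*) [MetricSpace X] (δ : ℝ) : Prop :=
  ∀ o x y z : X, min (gromovProduct o x y) (gromovProduct o y z) - δ ≤ gromovProduct o x z

/-- The form of the four-point condition without a base point, convenient for bounding a distance
directly. -/
theorem FourPoint.dist_add_dist_le {δ : ℝ} (hδ : FourPoint X δ) (p q y z : X) :
    dist p q + dist y z ≤ max (dist p y + dist q z) (dist p z + dist q y) + 2 * δ := by
  have h := hδ y p z q
  unfold gromovProduct at h
  rcases le_total (dist p y + dist q z) (dist p z + dist q y) with h' | h'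
  · rw [max_eq_right h']
    have := dist_comm z q
    have := dist_comm p y
    have := dist_comm q y
    rcases min_choice ((dist y p + dist y z - dist p z) / 2)
      ((dist y z + dist y q - dist z q) / 2) with h1 | h1 <;> rw [h1] at h <;> linarith
  · rw [max_eq_left h']
    have := dist_comm z q
    have := dist_comm p y
    have := dist_comm q y
    rcases min_choice ((dist y p + dist y z - dist p z) / 2)
      ((dist y z + dist y q - dist z q) / 2) with h1 | h1 <;> rw [h1] at h <;> linarith

/-- If the product of the outer pair is small and that of one inner pair is large, then the
product of the other inner pair is small. -/
theorem FourPoint.le_of_lt {δ b : ℝ} (hδ : FourPoint X δ) {o x y z : X}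
    (h : gromovProduct o x z ≤ b) (h' : b + δ < gromovProduct o y z) :
    gromovProduct o x y ≤ b + δ := by
  have h1 := hδ o x y z
  rcases min_choice (gromovProduct o x y) (gromovProduct o y z) with h2 | h2 <;>
    rw [h2] at h1 <;> linarith

/-- Halving the chain costs one `δ` per level, so the loss is only logarithmic in the number of
steps. -/
theorem FourPoint.chain {δ : ℝ} (hδ0 : 0 ≤ δ) (hδ : FourPoint X δ) (o : X) (b : ℝ) (k : ℕ) :
    ∀ (n : ℕ) (p : ℕ → X), 1 ≤ n → n ≤ 2 ^ k →
      (∀ i < n, b ≤ gromovProduct o (p i) (p (i + 1))) →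
      b - k * δ ≤ gromovProduct o (p 0) (p n) := by
  induction k with
  | zero =>
    intro n p h1 h2 h
    obtain rfl : n = 1 := by simpa using le_antisymm h2 h1
    simpa using h 0 one_pos
  | succ k ih =>
    intro n p h1 h2 h
    rcases le_or_gt n (2 ^ k) with hn | hn
    · have := ih n p h1 hn h
      push_cast
      linarith
    · have e1 := ih (2 ^ k) p Nat.one_le_two_pow le_rfl fun i hi => h i (hi.trans hn)
      have e2 := ih (n - 2 ^ k) (fun i => p (i + 2 ^ k)) (by omega) (by rw [pow_succ] at h2; omega)
        fun i hi => by
          have := h (i + 2 ^ k) (by omega)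
          rwa [show i + 2 ^ k + 1 = i + 1 + 2 ^ k by ring] at this
      simp only [zero_add, Nat.sub_add_cancel hn.le] at e2
      have e3 := hδ o (p 0) (p (2 ^ k)) (p n)
      have e4 := le_min e1 e2
      push_cast
      linarith

/-- Exponential growth beats linear growth: beyond some `K`, a `D` that is at most the value for `k
+ 1` also satisfies the premise for `k`, so `D` above the value at `K` would exceed all later
values. -/
theorem exists_pow_bound {δ c : ℝ} (hδ : 0 < δ) (hc : 0 ≤ c) :
    ∃ D₀ : ℝ, 0 ≤ D₀ ∧ ∀ D : ℝ,
      (∀ k : ℕ, c * (6 * D + 1) ≤ 2 ^ k → D ≤ c + (k + 2) * δ) → D ≤ D₀ := by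
  have h1 : ∀ᶠ k : ℕ in atTop, c * (6 * (c + (k + 3) * δ) + 1) ≤ 2 ^ k := by
    have e : (fun k : ℕ => c * (6 * (c + ((k : ℝ) + 3) * δ) + 1)) =o[atTop]
        fun k : ℕ => (2 : ℝ) ^ k := by
      have e1 : (fun k : ℕ => (k : ℝ)) =o[atTop] fun k : ℕ => (2 : ℝ) ^ k := by
        simpa using isLittleO_pow_const_const_pow_of_one_lt (R := ℝ) 1 one_lt_two
      have e2 : (fun _ : ℕ => c * (6 * (c + 3 * δ) + 1)) =o[atTop] fun k : ℕ => (2 : ℝ) ^ k := by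
        rw [Asymptotics.isLittleO_const_left]
        right
        exact tendsto_norm_atTop_atTop.comp (tendsto_pow_atTop_atTop_of_one_lt one_lt_two)
      refine ((e1.const_mul_left (6 * c * δ)).add e2).congr_left fun k => ?_
      ring
    filter_upwards [e.bound one_pos] with k hk
    rw [one_mul, Real.norm_eq_abs, Real.norm_eq_abs, abs_of_pos (a := (2 : ℝ) ^ k) (by positivity)]
      at hk
    exact (le_abs_self _).trans hk
  obtain ⟨K, hK⟩ := eventually_atTop.1 h1
  refine ⟨c + (K + 2) * δ, by positivity, fun D hD => ?_⟩
  by_contra! hlt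
  have key : ∀ j : ℕ, c + ((K + j : ℕ) + 2) * δ < D := by
    intro j
    induction j with
    | zero => simpa using hlt
    | succ j ih =>
      by_contra! hle
      have hle' : D ≤ c + ((K + j : ℕ) + 3) * δ := by
        push_cast at hle ⊢
        linarith
      have h2 := hK (K + j) (by omega)
      have h3 : c * (6 * D + 1) ≤ 2 ^ (K + j) :=
        (mul_le_mul_of_nonneg_left (by linarith) hc).trans h2
      exact absurd (hD _ h3) (not_le.2 ih)
  obtain ⟨j, hj⟩ := exists_nat_gt (D / δ)
  rw [div_lt_iff₀ hδ] at hj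
  have := key j
  push_cast at this
  have : 0 ≤ (K : ℝ) * δ := by positivity
  nlinarith

/-- Every point of a geodesic is close to each discrete quasigeodesic with the same end points. -/
theorem FourPoint.exists_dist_geodesic_le {δ c : ℝ} (hδ0 : 0 < δ) (hδ : FourPoint X δ)
    (hc : 0 ≤ c) :
    ∃ D₀ : ℝ, 0 ≤ D₀ ∧ ∀ (n : ℕ) (p : ℕ → X),
      (∀ i < n, dist (p i) (p (i + 1)) ≤ c) →
      (∀ i j, i ≤ j → j ≤ n → ((j : ℝ) - i) ≤ c * (dist (p i) (p j) + 1)) →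
      ∀ γ : ℝ → X, γ 0 = p 0 → γ (dist (p 0) (p n)) = p n →
      (∀ s ∈ Set.Icc (0 : ℝ) (dist (p 0) (p n)), ∀ t ∈ Set.Icc (0 : ℝ) (dist (p 0) (p n)),
        dist (γ s) (γ t) = |s - t|) →
      ∀ t ∈ Set.Icc (0 : ℝ) (dist (p 0) (p n)), ∃ i ≤ n, dist (γ t) (p i) ≤ D₀ := by
  obtain ⟨D₀, hD₀, hD⟩ := exists_pow_bound hδ0 hc
  refine ⟨D₀, hD₀, ?_⟩
  intro n p hstep hqi γ h0 hl hγ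
  set l := dist (p 0) (p n) with hldef
  have hl0 : 0 ≤ l := dist_nonneg
  let P : Set X := p '' Set.Iic n
  have hPne : P.Nonempty := ⟨p 0, 0, Nat.zero_le _, rfl⟩
  have hPc : IsCompact P := ((Set.finite_Iic n).image p).isCompact
  have hnear : ∀ q : X, ∃ i ≤ n, dist q (p i) = Metric.infDist q P := by
    intro q
    obtain ⟨_, ⟨i, hi, rfl⟩, h⟩ := hPc.exists_infDist_eq_dist hPne q
    exact ⟨i, hi, h.symm⟩
  have hinf : ∀ q : X, ∀ i ≤ n, Metric.infDist q P ≤ dist q (p i) := fun q i hi =>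
    Metric.infDist_le_dist_of_mem ⟨i, hi, rfl⟩
  have hcont : ContinuousOn γ (Set.Icc 0 l) := by
    rw [Metric.continuousOn_iff]
    intro s hs ε hε
    exact ⟨ε, hε, fun t ht h => by rwa [hγ t ht s hs, ← Real.dist_eq]⟩
  -- The point of the geodesic farthest from the path, at distance `D`. A detour around it goes `2 *
  -- D` along the geodesic to each side (or to its end), then across to the path, and along the
  -- path.
  obtain ⟨t₀, ht₀, hmax⟩ := isCompact_Icc.exists_isMaxOn (Set.nonempty_Icc.2 hl0)
    ((Metric.continuous_infDist_pt P).comp_continuousOn hcont)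
  set D := Metric.infDist (γ t₀) P with hDdef
  have hmax' : ∀ t ∈ Set.Icc 0 l, Metric.infDist (γ t) P ≤ D := fun t ht => hmax ht
  have hDpos : 0 ≤ D := Metric.infDist_nonneg
  suffices hDD : D ≤ D₀ by
    intro t ht
    obtain ⟨i, hi, h⟩ := hnear (γ t)
    exact ⟨i, hi, h.trans_le ((hmax' t ht).trans hDD)⟩
  -- nearby points of the path on either side of `γ t₀`
  have side : ∀ s ∈ Set.Icc 0 l, (|t₀ - s| = 2 * D ∨ (|t₀ - s| ≤ 2 * D ∧ ∃ i ≤ n, γ s = p i)) →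
      ∃ i ≤ n, dist (γ s) (p i) ≤ D ∧ D ≤ gromovProduct (γ t₀) (γ s) (p i) := by
    rintro s hs (h | ⟨h, i, hi, h'⟩)
    · obtain ⟨i, hi, h1⟩ := hnear (γ s)
      refine ⟨i, hi, h1.trans_le (hmax' s hs), ?_⟩
      have := dist_sub_dist_le_gromovProduct (γ t₀) (γ s) (p i)
      rw [hγ t₀ ht₀ s hs, h, h1] at this
      linarith [hmax' s hs]
    · refine ⟨i, hi, by simpa [h'] using hDpos, ?_⟩
      have := dist_sub_dist_le_gromovProduct (γ t₀) (γ s) (p i)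
      rw [h', dist_self] at this
      rw [h']
      linarith [hinf (γ t₀) i hi]
  obtain ⟨s₁, hs₁, hs₁t, hs₁D, a, ha, ha1, ha2⟩ : ∃ s ∈ Set.Icc 0 l, s ≤ t₀ ∧ t₀ - s ≤ 2 * D ∧
      ∃ i ≤ n, dist (γ s) (p i) ≤ D ∧ D ≤ gromovProduct (γ t₀) (γ s) (p i) := by
    rcases le_total 0 (t₀ - 2 * D) with h | h
    · have hs : t₀ - 2 * D ∈ Set.Icc 0 l := ⟨h, by linarith [ht₀.2]⟩
      refine ⟨_, hs, by linarith, by linarith, side _ hs (Or.inl ?_)⟩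
      rw [abs_of_nonneg] <;> linarith
    · have hs : (0 : ℝ) ∈ Set.Icc 0 l := ⟨le_rfl, hl0⟩
      refine ⟨_, hs, ht₀.1, by linarith, side _ hs (Or.inr ⟨?_, 0, Nat.zero_le _, h0⟩)⟩
      rw [abs_of_nonneg] <;> linarith [ht₀.1]
  obtain ⟨s₂, hs₂, hs₂t, hs₂D, b, hb, hb1, hb2⟩ : ∃ s ∈ Set.Icc 0 l, t₀ ≤ s ∧ s - t₀ ≤ 2 * D ∧
      ∃ i ≤ n, dist (γ s) (p i) ≤ D ∧ D ≤ gromovProduct (γ t₀) (γ s) (p i) := by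
    rcases le_total (t₀ + 2 * D) l with h | h
    · have hs : t₀ + 2 * D ∈ Set.Icc 0 l := ⟨by linarith [ht₀.1], h⟩
      refine ⟨_, hs, by linarith, by linarith, side _ hs (Or.inl ?_)⟩
      rw [abs_of_nonpos] <;> linarith
    · have hs : l ∈ Set.Icc 0 l := ⟨hl0, le_rfl⟩
      refine ⟨_, hs, ht₀.2, by linarith, side _ hs (Or.inr ⟨?_, n, le_rfl, hl⟩)⟩
      rw [abs_of_nonpos] <;> linarith [ht₀.2]
  have hs12 : dist (γ s₁) (γ s₂) = s₂ - s₁ := by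
    rw [hγ _ hs₁ _ hs₂, abs_of_nonpos] <;> linarith
  have hab : dist (p a) (p b) ≤ 6 * D := by
    have e1 := dist_triangle (p a) (γ s₁) (p b)
    have e2 := dist_triangle (γ s₁) (γ s₂) (p b)
    rw [dist_comm (p a) (γ s₁)] at e1
    linarith
  -- Seen from `γ t₀`, the ends of the detour have product `0`, whereas the chain estimate makes it
  -- at least `D - c - (k + 2) * δ`.
  have hzero : gromovProduct (γ t₀) (γ s₁) (γ s₂) = 0 := by
    unfold gromovProduct
    rw [hs12, hγ _ ht₀ _ hs₁, hγ _ ht₀ _ hs₂, abs_of_nonneg (by linarith : 0 ≤ t₀ - s₁),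
      abs_of_nonpos (by linarith : t₀ - s₂ ≤ 0)]
    ring
  apply hD
  intro k hk
  -- This stretch of path has at most `c * (6 * D + 1) ≤ 2 ^ k` steps, and its points are at
  -- distance at least `D` from `γ t₀`.
  have sub : ∀ i j, i ≤ j → j ≤ n → dist (p i) (p j) ≤ 6 * D →
      D - c - k * δ ≤ gromovProduct (γ t₀) (p i) (p j) := by
    intro i j hij hj hd
    rcases hij.eq_or_lt with rfl | hlt
    · have := dist_sub_dist_le_gromovProduct (γ t₀) (p i) (p i)
      rw [dist_self] at this
      have := hinf (γ t₀) i hj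
      have : 0 ≤ k * δ := by positivity
      linarith
    · have h1 : ((j - i : ℕ) : ℝ) ≤ 2 ^ k := by
        rw [Nat.cast_sub hij]
        exact (hqi i j hij hj).trans ((mul_le_mul_of_nonneg_left (by linarith) hc).trans hk)
      have h2 := hδ.chain hδ0.le (γ t₀) (D - c) k (j - i) (fun m => p (i + m)) (by omega)
        (by exact_mod_cast h1) fun m hm => by
          have e1 := dist_sub_dist_le_gromovProduct (γ t₀) (p (i + m)) (p (i + m + 1))
          have e2 := hinf (γ t₀) (i + m) (by omega)
          have e3 := hstep (i + m) (by omega)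
          rw [← add_assoc]
          linarith
      simpa [Nat.add_sub_cancel' hij] using h2
  have hmid : D - c - k * δ ≤ gromovProduct (γ t₀) (p a) (p b) := by
    rcases le_total a b with h | h
    · exact sub a b h hb hab
    · rw [gromovProduct_comm]
      exact sub b a h ha (by rwa [dist_comm])
  rw [gromovProduct_comm] at hb2
  have hkδ : 0 ≤ k * δ := by positivity
  have f1 := hδ (γ t₀) (p a) (p b) (γ s₂)
  have f2 := hδ (γ t₀) (γ s₁) (p a) (γ s₂)
  have f3 : D - c - k * δ ≤
      min (gromovProduct (γ t₀) (p a) (p b)) (gromovProduct (γ t₀) (p b) (γ s₂)) :=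
    le_min hmid (by linarith)
  have f4 : D - c - k * δ - δ ≤
      min (gromovProduct (γ t₀) (γ s₁) (p a)) (gromovProduct (γ t₀) (p a) (γ s₂)) :=
    le_min (by linarith) (by linarith)
  linarith

/-- The Morse lemma for discrete quasigeodesics, in terms of Gromov products. -/
theorem FourPoint.exists_gromovProduct_le [IsGeodesicSpace X] {δ c : ℝ} (hδ0 : 0 < δ)
    (hδ : FourPoint X δ) (hc : 0 ≤ c) :
    ∃ D : ℝ, 0 ≤ D ∧ ∀ (n : ℕ) (p : ℕ → X),
      (∀ i < n, dist (p i) (p (i + 1)) ≤ c) →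
      (∀ i j, i ≤ j → j ≤ n → ((j : ℝ) - i) ≤ c * (dist (p i) (p j) + 1)) →
      ∀ m ≤ n, gromovProduct (p m) (p 0) (p n) ≤ D := by
  obtain ⟨D, hD0, hD⟩ := hδ.exists_dist_geodesic_le hδ0 hc
  refine ⟨c * (c * (2 * D + 2)) + D, by positivity, fun n p hstep hqi m hm => ?_⟩
  obtain ⟨γ, h0, hl, hγ⟩ := IsGeodesicSpace.exists_geodesic (p 0) (p n)
  have key := hD n p hstep hqi γ h0 hl hγ
  set l := dist (p 0) (p n)
  have hl0 : 0 ≤ l := dist_nonneg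
  -- The parameters close to the part of the path up to `p m`. Just below the supremum, a point of
  -- the geodesic is close to path points on both sides of `m`; their indices differ boundedly, so
  -- `p m` is close as well.
  let A : Set ℝ := {t | t ∈ Set.Icc 0 l ∧ ∃ i ≤ m, dist (γ t) (p i) ≤ D}
  have hA0 : (0 : ℝ) ∈ A := ⟨⟨le_rfl, hl0⟩, 0, Nat.zero_le _, by simpa [h0] using hD0⟩
  have hAb : BddAbove A := ⟨l, fun t ht => ht.1.2⟩
  obtain ⟨t, ⟨ht, i, him, hi⟩, hlt⟩ := exists_lt_of_lt_csSup ⟨0, hA0⟩ (sub_one_lt (sSup A))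
  obtain ⟨j, hmj, hjn, hj⟩ : ∃ j, m ≤ j ∧ j ≤ n ∧ dist (γ t) (p j) ≤ D + 1 := by
    rcases le_or_gt (t + 1) l with h | h
    · have ht' : t + 1 ∈ Set.Icc 0 l := ⟨by linarith [ht.1], h⟩
      obtain ⟨j, hj, hj'⟩ := key _ ht'
      refine ⟨j, ?_, hj, ?_⟩
      · by_contra! hlt'
        have : t + 1 ∈ A := ⟨ht', j, hlt'.le, hj'⟩
        linarith [le_csSup hAb this]
      · have := dist_triangle (γ t) (γ (t + 1)) (p j)
        rw [hγ t ht _ ht'] at this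
        norm_num at this
        linarith
    · refine ⟨n, hm, le_rfl, ?_⟩
      rw [← hl, hγ t ht l ⟨hl0, le_rfl⟩, abs_of_nonpos] <;> linarith [ht.2]
  have hij : dist (p i) (p j) ≤ 2 * D + 1 := by
    have := dist_triangle_left (p i) (p j) (γ t)
    linarith
  have hmi : (m : ℝ) - i ≤ c * (2 * D + 2) := by
    have h1 := hqi i j (him.trans hmj) hjn
    have h2 : c * (dist (p i) (p j) + 1) ≤ c * (2 * D + 2) :=
      mul_le_mul_of_nonneg_left (by linarith) hc
    have : (m : ℝ) ≤ j := by exact_mod_cast hmj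
    linarith
  have him' : dist (p i) (p m) ≤ c * ((m : ℝ) - i) := by
    have := dist_le_Ico_sum_of_dist_le (f := p) (d := fun _ => c) him
      (fun {k} _ hk => hstep k (hk.trans_le hm))
    rw [Finset.sum_const, Nat.card_Ico, nsmul_eq_mul, Nat.cast_sub him] at this
    linarith
  have hbt : dist (p 0) (γ t) + dist (γ t) (p n) = dist (p 0) (p n) := by
    have e1 := hγ 0 ⟨le_rfl, hl0⟩ t ht
    have e2 := hγ t ht l ⟨hl0, le_rfl⟩
    rw [h0, abs_of_nonpos (by linarith [ht.1])] at e1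
    rw [hl, abs_of_nonpos (by linarith [ht.2])] at e2
    change _ = l
    linarith
  have f1 := gromovProduct_le_dist_of_between (p m) hbt
  have f2 := dist_triangle (p m) (p i) (γ t)
  rw [dist_comm (p m) (p i), dist_comm (p i) (γ t)] at f2
  have f3 : c * ((m : ℝ) - i) ≤ c * (c * (2 * D + 2)) := mul_le_mul_of_nonneg_left hmi hc
  linarith

/-! ### Broken paths with long edges and small corner products -/

section BrokenChain

variable {δ C : ℝ} {p : ℕ → X} {n : ℕ}

/-- The error does not accumulate: the inductive bound only serves to show that, from the next
vertex, `p 0` and the preceding vertex have a large product, so that replacing one by the other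
costs a single `δ`. -/
theorem FourPoint.gromovProduct_first_le (hδ0 : 0 ≤ δ) (hδ : FourPoint X δ)
    (hp : ∀ i, i + 2 ≤ n → gromovProduct (p (i + 1)) (p i) (p (i + 2)) ≤ C)
    (hL : ∀ i < n, 2 * C + 3 * δ < dist (p i) (p (i + 1))) (i : ℕ) (hi : i + 2 ≤ n) :
    gromovProduct (p (i + 1)) (p 0) (p (i + 2)) ≤ C + δ := by
  induction i with
  | zero => linarith [hp 0 hi]
  | succ i ih =>
    have h1 := ih (by omega)
    have h2 := gromovProduct_add_gromovProduct (p (i + 2)) (p (i + 1)) (p 0)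
    rw [gromovProduct_comm (p (i + 1)), dist_comm] at h2
    have h3 := hL (i + 1) (by omega)
    have h4 := hp (i + 1) hi
    rw [gromovProduct_comm] at h4 ⊢
    refine hδ.le_of_lt h4 ?_
    rw [gromovProduct_comm]
    linarith

theorem FourPoint.dist_add_half_dist_le (hδ0 : 0 ≤ δ) (hδ : FourPoint X δ)
    (hp : ∀ i, i + 2 ≤ n → gromovProduct (p (i + 1)) (p i) (p (i + 2)) ≤ C)
    (hC : 0 ≤ C) (hL : ∀ i < n, 4 * C + 4 * δ < dist (p i) (p (i + 1))) (m : ℕ) (hm : m < n) :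
    dist (p 0) (p m) + dist (p m) (p (m + 1)) / 2 ≤ dist (p 0) (p (m + 1)) := by
  rcases m with _ | i
  · simp
  · have h2 := hδ.gromovProduct_first_le hδ0 hp (fun i hi => by linarith [hL i hi]) i (by omega)
    have h3 := hL (i + 1) (by omega)
    unfold gromovProduct at h2
    rw [dist_comm (p (i + 1)) (p 0)] at h2
    rw [show i + 1 + 1 = i + 2 from rfl] at *
    linarith

theorem FourPoint.gromovProduct_ends_le (hδ0 : 0 ≤ δ) (hδ : FourPoint X δ)
    (hp : ∀ i, i + 2 ≤ n → gromovProduct (p (i + 1)) (p i) (p (i + 2)) ≤ C)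
    (hC : 0 ≤ C) (hL : ∀ i < n, 2 * C + 3 * δ < dist (p i) (p (i + 1))) (m : ℕ) (hm : m ≤ n) :
    gromovProduct (p m) (p 0) (p n) ≤ C + 2 * δ := by
  rcases m with _ | m
  · have := gromovProduct_le_dist_left (p 0) (p 0) (p n)
    rw [dist_self] at this
    linarith
  rcases hm.eq_or_lt with rfl | hlt
  · have := gromovProduct_le_dist_right (p (m + 1)) (p 0) (p (m + 1))
    rw [dist_self] at this
    linarith
  -- The preceding estimate for the reversed path; a second `δ` then replaces `p m` by `p 0`.
  have h1 : gromovProduct (p (m + 1)) (p n) (p m) ≤ C + δ := by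
    have := hδ.gromovProduct_first_le (p := fun i => p (n - i)) (n := n) hδ0 (C := C)
      (fun i hi => by
        have := hp (n - (i + 2)) (by omega)
        rw [show n - (i + 2) + 1 = n - (i + 1) by omega, show n - (i + 2) + 2 = n - i by omega,
          gromovProduct_comm] at this
        exact this)
      (fun i hi => by
        have := hL (n - (i + 1)) (by omega)
        rw [show n - (i + 1) + 1 = n - i by omega, dist_comm] at this
        exact this) (n - (m + 2)) (by omega)
    simp only [Nat.sub_zero] at this
    rwa [show n - (n - (m + 2) + 1) = m + 1 by omega,
      show n - (n - (m + 2) + 2) = m by omega] at this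
  have h2 : C + 2 * δ < gromovProduct (p (m + 1)) (p 0) (p m) := by
    have h2 := gromovProduct_add_gromovProduct (p (m + 1)) (p m) (p 0)
    rw [gromovProduct_comm, dist_comm] at h2
    have h3 := hL m (by omega)
    rcases m with _ | i
    · have := gromovProduct_le_dist_right (p 0) (p 1) (p 0)
      rw [dist_self] at this
      linarith
    · have := hδ.gromovProduct_first_le hδ0 hp hL i (by omega)
      rw [gromovProduct_comm (p (i + 1))] at h2
      rw [show i + 1 + 1 = i + 2 from rfl] at *
      linarith
  rw [gromovProduct_comm]
  have := hδ.le_of_lt h1 (by linarith : C + δ + δ < gromovProduct (p (m + 1)) (p 0) (p m))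
  linarith

end BrokenChain

/-! ### Isometries that move two points little -/

section Displacement

variable {G : Type*} [Group G] [MulAction G X] [IsIsometricSMul G X]

theorem gromovProduct_smul (g : G) (o x y : X) :
    gromovProduct (g • o) (g • x) (g • y) = gromovProduct o x y := by
  simp [gromovProduct, dist_smul]

theorem FourPoint.dist_smul_le {δ C ε : ℝ} (hδ : FourPoint X δ) {g : G} {p y z : X}
    (hp : gromovProduct p y z ≤ C) (hy : dist (g • y) y ≤ ε) (hz : dist (g • z) z ≤ ε) :
    dist (g • p) p ≤ 2 * C + ε + 2 * δ := by
  have h1 := hδ.dist_add_dist_le (g • p) p y z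
  have h2 : dist (g • p) y ≤ dist p y + ε := by
    have := dist_triangle (g • p) (g • y) y
    rw [dist_smul] at this
    linarith
  have h3 : dist (g • p) z ≤ dist p z + ε := by
    have := dist_triangle (g • p) (g • z) z
    rw [dist_smul] at this
    linarith
  unfold gromovProduct at hp
  have h4 : max (dist (g • p) y + dist p z) (dist (g • p) z + dist p y) ≤
      dist p y + dist p z + ε := max_le (by linarith) (by linarith)
  linarith

/-- Far from `y` and `z`, the pairs `y`, `g • y` and `z`, `g • z` have large products seen from `g •
p`, so each can be exchanged for one `δ`. The resulting bound is free of `ε`. -/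
theorem FourPoint.gromovProduct_smul_le {δ C ε : ℝ} (hδ : FourPoint X δ) {g : G}
    {p y z : X} (hp : gromovProduct p y z ≤ C) (hy : dist (g • y) y ≤ ε)
    (hz : dist (g • z) z ≤ ε) (hpy : C + 2 * δ + ε < dist p y) (hpz : C + 2 * δ + ε < dist p z)
    (hδ0 : 0 ≤ δ) :
    gromovProduct (g • p) y z ≤ C + 2 * δ := by
  have h1 : gromovProduct (g • p) (g • z) (g • y) ≤ C := by
    rwa [gromovProduct_smul, gromovProduct_comm]
  have h2 := dist_sub_dist_le_gromovProduct (g • p) (g • y) y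
  have h3 := dist_sub_dist_le_gromovProduct (g • p) (g • z) z
  rw [dist_smul] at h2 h3
  rw [gromovProduct_comm] at h2 h3
  have h4 := hδ.le_of_lt h1 (by linarith : C + δ < gromovProduct (g • p) y (g • y))
  rw [gromovProduct_comm] at h4
  linarith [hδ.le_of_lt h4 (by linarith : C + δ + δ < gromovProduct (g • p) z (g • z))]

/-- Points near a geodesic from `y` to `z` are determined, up to a bounded error, by their distance
to `y`. -/
theorem FourPoint.dist_le_of_shift {δ C η : ℝ} (hδ : FourPoint X δ) {q q' y z : X}
    (hq : gromovProduct q y z ≤ C) (hq' : gromovProduct q' y z ≤ C)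
    (h : |dist q y - dist q' y| ≤ η) : dist q q' ≤ 2 * C + η + 2 * δ := by
  have h1 := hδ.dist_add_dist_le q q' y z
  obtain ⟨h2, h3⟩ := abs_le.1 h
  unfold gromovProduct at hq hq'
  have h4 : max (dist q y + dist q' z) (dist q z + dist q' y) ≤ 2 * C + η + dist y z :=
    max_le (by linarith) (by linarith)
  linarith

end Displacement

end Metric

/-! ### Word length -/

section WordLength

variable {A : Type*} [Group A] {S : Set A}

theorem exists_list_length_eq_wordLength (hS : Subgroup.closure S = ⊤) (a : A) :
    ∃ l : List A, l.length = wordLength S a ∧ (∀ s ∈ l, s ∈ S ∨ s⁻¹ ∈ S) ∧ l.prod = a := by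
  refine Nat.sInf_mem (s := {n | ∃ l : List A, l.length = n ∧ (∀ s ∈ l, s ∈ S ∨ s⁻¹ ∈ S) ∧
    l.prod = a}) ?_
  have ha : a ∈ (Subgroup.closure S).toSubmonoid := by
    rw [hS]
    trivial
  rw [Subgroup.closure_toSubmonoid] at ha
  obtain ⟨l, h1, h2⟩ := Submonoid.exists_list_of_mem_closure ha
  exact ⟨l.length, l, rfl, fun s hs => by simpa using h1 s hs, h2⟩

theorem wordLength_prod_le {l : List A} (hl : ∀ s ∈ l, s ∈ S ∨ s⁻¹ ∈ S) :
    wordLength S l.prod ≤ l.length :=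
  Nat.sInf_le ⟨l, rfl, hl, rfl⟩

theorem wordLength_one : wordLength S (1 : A) = 0 :=
  Nat.le_zero.1 (wordLength_prod_le (l := []) (by simp))

theorem wordLength_mul_le (hS : Subgroup.closure S = ⊤) (a b : A) :
    wordLength S (a * b) ≤ wordLength S a + wordLength S b := by
  obtain ⟨l, hl, hlS, rfl⟩ := exists_list_length_eq_wordLength hS a
  obtain ⟨l', hl', hlS', rfl⟩ := exists_list_length_eq_wordLength hS b
  rw [← hl, ← hl', ← List.length_append, ← List.prod_append]
  refine wordLength_prod_le fun s hs => ?_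
  rcases List.mem_append.1 hs with h | h
  exacts [hlS s h, hlS' s h]

theorem wordLength_map_le {B : Type*} [Group B] {T : Set B} (hS : Subgroup.closure S = ⊤)
    (f : A →* B) (hf : ∀ s ∈ S, f s ∈ T) (a : A) : wordLength T (f a) ≤ wordLength S a := by
  obtain ⟨l, hl, hlS, rfl⟩ := exists_list_length_eq_wordLength hS a
  rw [← hl, map_list_prod, ← List.length_map (f := f)]
  refine wordLength_prod_le fun s hs => ?_
  obtain ⟨t, ht, rfl⟩ := List.mem_map.1 hs
  rw [← map_inv]
  exact (hlS t ht).imp (hf _) (hf _)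

/-- A subadditive function is at most linear in the word length. -/
theorem exists_le_mul_wordLength (hS : IsFiniteGeneratingSet S) (ℓ : A → ℝ) (h1 : ℓ 1 ≤ 0)
    (hmul : ∀ a b, ℓ (a * b) ≤ ℓ a + ℓ b) :
    ∃ c : ℝ, 0 ≤ c ∧ ∀ a, ℓ a ≤ c * wordLength S a := by
  obtain ⟨c, hc⟩ := ((hS.1.union hS.1.inv).image ℓ).bddAbove
  refine ⟨max c 0, le_max_right _ _, fun a => ?_⟩
  obtain ⟨l, hl, hlS, rfl⟩ := exists_list_length_eq_wordLength hS.2 a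
  rw [← hl]
  clear hl
  induction l with
  | nil => simpa using h1
  | cons b l ih =>
    have h2 : ℓ b ≤ c := hc ⟨b, by simpa using hlS b (by simp), rfl⟩
    have h3 := ih fun s hs => hlS s (List.mem_cons_of_mem _ hs)
    have h4 := hmul b l.prod
    rw [List.prod_cons, List.length_cons]
    push_cast
    linarith [le_max_left c 0]

theorem finite_wordLength_le (hS : IsFiniteGeneratingSet S) (n : ℕ) :
    {a : A | wordLength S a ≤ n}.Finite := by
  have key : ∀ n : ℕ,
      {a | ∃ l : List A, l.length = n ∧ (∀ s ∈ l, s ∈ S ∨ s⁻¹ ∈ S) ∧ l.prod = a}.Finite := by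
    intro n
    induction n with
    | zero =>
      refine (Set.finite_singleton (1 : A)).subset ?_
      rintro _ ⟨l, hl, -, rfl⟩
      simp [List.length_eq_zero_iff.1 hl]
    | succ n ih =>
      refine ((hS.1.union hS.1.inv).image2 (· * ·) ih).subset ?_
      rintro _ ⟨l, hl, hlS, rfl⟩
      rcases l with _ | ⟨b, l⟩
      · simp at hl
      · exact ⟨b, by simpa using hlS b (by simp), l.prod, ⟨l, by simpa using hl,
          fun s hs => hlS s (List.mem_cons_of_mem _ hs), rfl⟩, by simp⟩
  refine ((Set.finite_Iic n).biUnion fun m _ => key m).subset fun a ha => ?_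
  exact Set.mem_biUnion (x := wordLength S a) ha (exists_list_length_eq_wordLength hS.2 a)

theorem exists_word_geodesic (hS : Subgroup.closure S = ⊤) (a : A) :
    ∃ q : ℕ → A, q 0 = 1 ∧ q (wordLength S a) = a ∧
      ∀ i j, i ≤ j → j ≤ wordLength S a → wordLength S ((q i)⁻¹ * q j) = j - i := by
  obtain ⟨l, hl, hlS, hla⟩ := exists_list_length_eq_wordLength hS a
  have hle : ∀ i j, i ≤ j → j ≤ wordLength S a →
      wordLength S (((l.take i).prod)⁻¹ * (l.take j).prod) ≤ j - i := by
    intro i j hij hj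
    have h1 : ((l.take i).prod)⁻¹ * (l.take j).prod = ((l.take j).drop i).prod := by
      rw [inv_mul_eq_iff_eq_mul]
      conv_lhs => rw [← List.prod_take_mul_prod_drop (l.take j) i]
      rw [List.take_take, min_eq_left hij]
    rw [h1]
    refine (wordLength_prod_le fun s hs =>
      hlS s (List.mem_of_mem_take (List.mem_of_mem_drop hs))).trans ?_
    simp
    omega
  have hlast : (l.take (wordLength S a)).prod = a := by rw [← hl, List.take_length, hla]
  refine ⟨fun i => (l.take i).prod, by simp, hlast, fun i j hij hj => ?_⟩
  -- The three pieces of the word have lengths at most `i`, `j - i` and the remainder, and must add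
  -- up to at least the length of `a`.
  refine le_antisymm (hle i j hij hj) ?_
  have h1 := hle 0 i (Nat.zero_le _) (hij.trans hj)
  have h2 := hle j _ hj le_rfl
  rw [hlast] at h2
  have h3 := wordLength_mul_le hS (l.take i).prod (((l.take i).prod)⁻¹ * (l.take j).prod)
  have h4 := wordLength_mul_le hS (l.take j).prod (((l.take j).prod)⁻¹ * a)
  simp only [mul_inv_cancel_left, List.take_zero, List.prod_nil, inv_one, one_mul] at h1 h3 h4 ⊢
  omega

end WordLength

/-! ### Quasi-isometric orbits and change of base point -/

section Orbit

variable {G X : Type*} [Group G] [MetricSpace X] [MulAction G X]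

/-- The orbit map of `H` at `x` is a quasi-isometric embedding, with a single constant `c`. -/
def OrbitQIBound {H : Subgroup G} (S : Set H) (x : X) (c : ℝ) : Prop :=
  ∀ a : H, (wordLength S a : ℝ) ≤ c * (dist x ((a : G) • x) + 1) ∧
    dist x ((a : G) • x) ≤ c * wordLength S a

theorem OrbitQIBound.mono {H : Subgroup G} {S : Set H} {x : X} {c c' : ℝ}
    (h : OrbitQIBound S x c) (hc : c ≤ c') : OrbitQIBound S x c' := fun a =>
  ⟨(h a).1.trans (mul_le_mul_of_nonneg_right hc (by positivity)),
    (h a).2.trans (mul_le_mul_of_nonneg_right hc (by positivity))⟩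

theorem OrbitQIBound.finite_dist_lt {H : Subgroup G} {S : Set H}
    (hS : IsFiniteGeneratingSet S) {x : X} {c : ℝ} (hc0 : 0 ≤ c) (hc : OrbitQIBound S x c) (L : ℝ) :
    {h : G | h ∈ H ∧ dist x (h • x) < L}.Finite := by
  refine ((finite_wordLength_le hS ⌊c * (L + 1)⌋₊).image ((↑) : H → G)).subset ?_
  rintro h ⟨hH, hL⟩
  refine ⟨⟨h, hH⟩, Nat.le_floor ?_, rfl⟩
  exact (hc ⟨h, hH⟩).1.trans (mul_le_mul_of_nonneg_left (by simpa using hL.le) hc0)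

variable [IsIsometricSMul G X]

theorem dist_smul_smul_right (g h : G) (x : X) : dist (g • x) (h • x) = dist x ((g⁻¹ * h) • x) := by
  rw [← dist_smul g x, mul_smul, smul_inv_smul]

theorem dist_mul_smul_le (x : X) (g h : G) :
    dist x ((g * h) • x) ≤ dist x (g • x) + dist x (h • x) := by
  have := dist_triangle x (g • x) ((g * h) • x)
  rw [mul_smul] at this ⊢
  rwa [dist_smul] at this

theorem exists_orbitQIBound {H : Subgroup G} {S : Set H} (hS : IsFiniteGeneratingSet S) (x : X)
    {c : ℝ} (hc : ∀ a : H, (wordLength S a : ℝ) ≤ c * (dist x ((a : G) • x) + 1)) :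
    ∃ c : ℝ, 0 ≤ c ∧ OrbitQIBound S x c := by
  obtain ⟨c', hc', h'⟩ := exists_le_mul_wordLength hS (fun a : H => dist x ((a : G) • x))
    (by simp) fun a b => dist_mul_smul_le x (a : G) b
  refine ⟨max c c', hc'.trans (le_max_right _ _), fun a => ⟨(hc a).trans ?_, (h' a).trans ?_⟩⟩
  · exact mul_le_mul_of_nonneg_right (le_max_left _ _) (by positivity)
  · exact mul_le_mul_of_nonneg_right (le_max_right _ _) (by positivity)

theorem OrbitQIBound.isQIEmbeddedByAction {H : Subgroup G} {S : Set H}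
    (hS : IsFiniteGeneratingSet S) {x : X} {c : ℝ} (h : OrbitQIBound S x c) :
    IsQIEmbeddedByAction X H := by
  refine ⟨S, hS, x, max c 1, le_max_right _ _, fun a b => ?_⟩
  obtain ⟨h1, h2⟩ := h (a⁻¹ * b)
  have hpos : 0 < max c 1 := lt_max_of_lt_right one_pos
  have hd : dist ((a : G) • x) ((b : G) • x) = dist x (((a⁻¹ * b : H) : G) • x) := by
    simp [dist_smul_smul_right]
  simp only [wordDist]
  rw [hd]
  have h0 : 0 ≤ dist x (((a⁻¹ * b : H) : G) • x) := dist_nonneg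
  constructor
  · have h3 : (wordLength S (a⁻¹ * b) : ℝ) ≤ max c 1 * (dist x (((a⁻¹ * b : H) : G) • x) + 1) :=
      h1.trans (mul_le_mul_of_nonneg_right (le_max_left _ _) (by positivity))
    have h4 := mul_le_mul_of_nonneg_left h3 (inv_nonneg.2 hpos.le)
    rw [inv_mul_cancel_left₀ hpos.ne'] at h4
    linarith [le_max_right c 1]
  · refine h2.trans (le_add_of_le_of_nonneg ?_ hpos.le)
    exact mul_le_mul_of_nonneg_right (le_max_left _ _) (by positivity)

theorem IsQIEmbeddedByAction.exists_bound {H : Subgroup G} (h : IsQIEmbeddedByAction X H)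
    {S : Set H} (hS : IsFiniteGeneratingSet S) (x : X) : ∃ c : ℝ, 0 ≤ c ∧ OrbitQIBound S x c := by
  obtain ⟨T, hT, y, τ, hτ, hqi⟩ := h
  obtain ⟨c, hc0, hc⟩ := exists_le_mul_wordLength hT (fun a => (wordLength S a : ℝ))
    (by simp [wordLength_one]) fun a b => by exact_mod_cast wordLength_mul_le hS.2 a b
  have hτ0 : 0 < τ := by linarith
  refine exists_orbitQIBound hS x (c := c * (τ * (2 * dist x y + τ + 1))) fun a => ?_
  have h1 := (hqi 1 a).1
  simp only [wordDist, inv_one, one_mul, OneMemClass.coe_one, one_smul] at h1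
  have h2 : dist y ((a : G) • y) ≤ dist x ((a : G) • x) + 2 * dist x y := by
    have e1 := dist_triangle y x ((a : G) • y)
    have e2 := dist_triangle x ((a : G) • x) ((a : G) • y)
    rw [dist_smul] at e2
    linarith [dist_comm x y]
  have h3 : (wordLength T a : ℝ) ≤ τ * (dist x ((a : G) • x) + 2 * dist x y + τ) := by
    rw [← inv_mul_le_iff₀ hτ0]
    linarith
  have h4 : τ * (dist x ((a : G) • x) + 2 * dist x y + τ) ≤
      τ * (2 * dist x y + τ + 1) * (dist x ((a : G) • x) + 1) := by
    have : 0 ≤ (2 * dist x y + τ) * dist x ((a : G) • x) := by positivity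
    nlinarith
  calc (wordLength S a : ℝ) ≤ c * wordLength T a := hc a
    _ ≤ c * (τ * (2 * dist x y + τ + 1) * (dist x ((a : G) • x) + 1)) :=
      mul_le_mul_of_nonneg_left (h3.trans h4) hc0
    _ = _ := by ring

theorem IsQIEmbeddedSubgroup.exists_bound {K H : Subgroup G} {hKH : K ≤ H}
    (hK : IsQIEmbeddedSubgroup hKH) (hH : IsQIEmbeddedByAction X H) (x : X) :
    ∃ S : Set K, IsFiniteGeneratingSet S ∧ ∃ c : ℝ, 0 ≤ c ∧ OrbitQIBound S x c := by
  obtain ⟨S, T, hS, hT, τ, hτ, hqi⟩ := hK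
  obtain ⟨c, hc0, hc⟩ := hH.exists_bound hT x
  refine ⟨S, hS, exists_orbitQIBound hS x (c := τ * (c + τ)) fun a => ?_⟩
  have hτ0 : 0 < τ := by linarith
  have h1 := (hqi 1 a).1
  simp only [wordDist, inv_one, one_mul, map_one] at h1
  have h2 := (hc (Subgroup.inclusion hKH a)).1
  rw [Subgroup.coe_inclusion] at h2
  have h3 : (wordLength S a : ℝ) ≤ τ * (c * (dist x ((a : G) • x) + 1) + τ) := by
    rw [← inv_mul_le_iff₀ hτ0]
    linarith
  refine h3.trans ?_
  rw [mul_assoc]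
  refine mul_le_mul_of_nonneg_left ?_ hτ0.le
  have : 0 ≤ τ * dist x ((a : G) • x) := by positivity
  nlinarith

/-- Acylindricity along `H`, tested on the orbit of `x` and on pairs one of whose points is `x`. -/
theorem IsAcylindricalAlong.exists_bound {H : Subgroup G} (h : IsAcylindricalAlong X H) (x : X)
    {ε : ℝ} (hε : 0 ≤ ε) :
    ∃ R : ℝ, 0 < R ∧ ∃ M : ℕ, 0 < M ∧ ∀ a ∈ H, R ≤ dist x (a • x) →
      {g : G | dist (g • x) x ≤ ε ∧ dist (g • a • x) (a • x) ≤ ε}.encard ≤ (M : ℕ∞) := by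
  obtain ⟨y, hy⟩ := h
  -- Passing from `y` to `x` changes displacements, and distances between orbit points, by at most
  -- `2 * dist x y`.
  obtain ⟨R, hR, M, hM, hRM⟩ := hy (ε + 2 * dist x y) (by positivity)
  have move : ∀ (g a : G), dist (g • a • x) (a • x) ≤ ε →
      dist (g • a • y) (a • y) ≤ ε + 2 * dist x y := by
    intro g a hg
    have e1 := dist_triangle4 (g • a • y) (g • a • x) (a • x) (a • y)
    rw [dist_smul, dist_smul, dist_smul] at e1
    linarith [dist_comm x y]
  refine ⟨R + 2 * dist x y, by positivity, M, hM, fun a ha hd => ?_⟩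
  refine (Set.encard_le_encard ?_).trans (hRM y ⟨1, H.one_mem, one_smul _ _⟩ (a • y) ⟨a, ha, rfl⟩ ?_)
  · rintro g ⟨h1, h2⟩
    exact ⟨by simpa using move g 1 (by simpa using h1), move g a h2⟩
  · have e1 := dist_triangle4 x y (a • y) (a • x)
    rw [dist_smul] at e1
    linarith [dist_comm x y]

theorem exists_uniform_acylindrical_bound {ι : Type*} [Fintype ι] {H : ι → Subgroup G}
    (h : ∀ i, IsAcylindricalAlong X (H i)) (x : X) {ε : ℝ} (hε : 0 ≤ ε) :
    ∃ R : ℝ, 0 ≤ R ∧ ∃ M : ℕ, ∀ i, ∀ a ∈ H i, R ≤ dist x (a • x) →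
      {g : G | dist (g • x) x ≤ ε ∧ dist (g • a • x) (a • x) ≤ ε}.encard ≤ (M : ℕ∞) := by
  choose R hR M hM hRM using fun i => (h i).exists_bound x hε
  refine ⟨∑ i, R i, Finset.sum_nonneg fun i _ => (hR i).le, ∑ i, M i, fun i a ha hd => ?_⟩
  refine (hRM i a ha (le_trans ?_ hd)).trans ?_
  · exact Finset.single_le_sum (fun i _ => (hR i).le) (Finset.mem_univ i)
  · exact_mod_cast Finset.single_le_sum (f := M) (fun i _ => Nat.zero_le _) (Finset.mem_univ i)

end Orbit

/-! ### Extracting sequences that converge to infinity -/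

section Boundary

variable {X : Type*} [MetricSpace X]

theorem gromovProduct_le_add_dist (o o' x y : X) :
    gromovProduct o x y ≤ gromovProduct o' x y + dist o o' := by
  unfold gromovProduct
  linarith [dist_triangle o o' x, dist_triangle o o' y]

theorem FourPoint.of_le {δ δ' : ℝ} (hδ : FourPoint X δ) (h : δ ≤ δ') : FourPoint X δ' :=
  fun o x y z => by linarith [hδ o x y z]

theorem exists_fourPoint (X : Type*) [MetricSpace X] [IsGromovHyperbolic X] :
    ∃ δ : ℝ, 0 < δ ∧ FourPoint X δ := by
  obtain ⟨δ, hδ0, hδ⟩ := IsGromovHyperbolic.exists_delta (X := X)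
  exact ⟨δ + 1, by linarith, FourPoint.of_le (δ := δ) hδ (by linarith)⟩

/-- A sequence each of whose tails clusters, along the filter `f`, towards points with large Gromov
products. -/
def ClustersAtInfinity (f : Filter ℕ) (o : X) (u : ℕ → X) : Prop :=
  ∀ r : ℕ, ∃ w : X, ∀ᶠ n in f, (r : ℝ) ≤ gromovProduct o (u n) w

/-- The common subsequence of two clustering sequences converges to infinity. -/
theorem FourPoint.exists_subseq_convergesToInfinity {δ : ℝ} (hδ : FourPoint X δ)
    {f : Filter ℕ} [f.NeBot] (hf : f ≤ cofinite) {o : X} {u v : ℕ → X}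
    (hu : ClustersAtInfinity f o u) (hv : ClustersAtInfinity f o v) :
    ∃ φ : ℕ → ℕ, (∀ r, r ≤ φ r) ∧ ConvergesToInfinity (u ∘ φ) ∧ ConvergesToInfinity (v ∘ φ) := by
  choose a ha using hu
  choose b hb using hv
  -- A diagonal choice: the `r`-th index serves all levels `s ≤ r` and both sequences at once, since
  -- all the conditions hold along the same filter.
  have hex : ∀ r : ℕ, ∃ n, r ≤ n ∧ ∀ s ∈ Set.Iic r,
      (s : ℝ) ≤ gromovProduct o (u n) (a s) ∧ (s : ℝ) ≤ gromovProduct o (v n) (b s) := by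
    intro r
    have h1 : ∀ᶠ n in f, r ≤ n := hf (Nat.cofinite_eq_atTop ▸ eventually_ge_atTop r)
    have h2 := (eventually_all_finite (Set.finite_Iic r)).2 fun s _ => (ha s).and (hb s)
    exact (h1.and h2).exists
  choose φ hφ hφ' using hex
  have conv : ∀ (w : ℕ → X) (c : ℕ → X),
      (∀ r : ℕ, ∀ s ∈ Set.Iic r, (s : ℝ) ≤ gromovProduct o (w r) (c s)) → ConvergesToInfinity w := by
    intro w c hw o'
    rw [tendsto_atTop]
    intro B
    obtain ⟨s, hs⟩ := exists_nat_ge (B + δ + dist o o')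
    filter_upwards [eventually_ge_atTop (s, s)] with p hp
    have h1 := hw p.1 s hp.1
    have h2 := hw p.2 s hp.2
    rw [gromovProduct_comm] at h2
    have h3 := hδ o (w p.1) (c s) (w p.2)
    have h4 := le_min h1 h2
    have h5 := gromovProduct_le_add_dist o o' (w p.1) (w p.2)
    linarith
  exact ⟨φ, hφ, conv _ a fun r s hs => (hφ' r s hs).1, conv _ b fun r s hs => (hφ' r s hs).2⟩

end Boundary

/-! ### Disjoint limit sets and bounded Gromov products -/

section LimitSet

variable {G X : Type*} [Group G] [MetricSpace X] [MulAction G X] [IsIsometricSMul G X]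

/-- Far away orbit points fall into finitely many classes of large mutual Gromov products. -/
theorem OrbitQIBound.exists_finite_cover [IsGeodesicSpace X] [IsGromovHyperbolic X]
    {H : Subgroup G} {S : Set H} (hS : IsFiniteGeneratingSet S) {x : X} {c : ℝ} (hc0 : 0 ≤ c)
    (hc : OrbitQIBound S x c) (r : ℝ) :
    ∃ F : Set X, F.Finite ∧ ∃ N : ℝ, ∀ h ∈ H, N ≤ dist x (h • x) →
      ∃ w ∈ F, r ≤ gromovProduct x (h • x) w := by
  obtain ⟨δ, hδ0, hδ⟩ := exists_fourPoint X
  obtain ⟨D, hD0, hD⟩ := hδ.exists_gromovProduct_le hδ0 hc0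
  -- A word geodesic to a far `h` passes through an element of length `N`. By the Morse lemma its
  -- orbit point is nearly between `x` and `h • x`; `N` puts it farther than `r + D` from `x`.
  obtain ⟨N, hN⟩ := exists_nat_gt (c * (r + D + 1))
  refine ⟨_, ((finite_wordLength_le hS N).image fun a : H => (a : G) • x), c * N + 1, ?_⟩
  intro h hh hfar
  obtain ⟨q, hq0, hq1, hq⟩ := exists_word_geodesic hS.2 (⟨h, hh⟩ : H)
  set n := wordLength S (⟨h, hh⟩ : H)
  have hNn : N ≤ n := by
    by_contra! hlt
    have h1 := (hc ⟨h, hh⟩).2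
    have h2 : c * n ≤ c * N := mul_le_mul_of_nonneg_left (by exact_mod_cast hlt.le) hc0
    simp only at h1
    linarith
  have hdist : ∀ i j, dist ((q i : G) • x) ((q j : G) • x) =
      dist x ((((q i)⁻¹ * q j : H) : G) • x) := fun i j => by
    rw [dist_smul_smul_right]
    rfl
  have hmorse := hD n (fun i => (q i : G) • x)
    (fun i hi => by
      rw [hdist]
      have := (hc ((q i)⁻¹ * q (i + 1))).2
      rw [hq i (i + 1) (by omega) (by omega)] at this
      simpa using this)
    (fun i j hij hj => by
      rw [hdist]
      have := (hc ((q i)⁻¹ * q j)).1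
      rwa [hq i j hij hj, Nat.cast_sub hij] at this) N hNn
  have hqN := hq 0 N (Nat.zero_le _) hNn
  simp only [hq0, hq1, inv_one, one_mul, OneMemClass.coe_one, one_smul, Nat.sub_zero] at hmorse hqN
  refine ⟨_, ⟨q N, hqN.le, rfl⟩, ?_⟩
  have h1 := gromovProduct_add_gromovProduct x ((q N : G) • x) (h • x)
  have h2 := (hc (q N)).1
  rw [hqN] at h2
  have h3 : r + D + 1 ≤ dist x ((q N : G) • x) + 1 := by
    by_contra! hlt
    have := mul_le_mul_of_nonneg_left hlt.le hc0
    linarith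
  rw [gromovProduct_comm]
  linarith

theorem OrbitQIBound.clustersAtInfinity [IsGeodesicSpace X] [IsGromovHyperbolic X]
    {H : Subgroup G} {S : Set H} (hS : IsFiniteGeneratingSet S) {x : X} {c : ℝ} (hc0 : 0 ≤ c)
    (hc : OrbitQIBound S x c) {h : ℕ → G} (hh : ∀ n, h n ∈ H)
    (hd : ∀ n : ℕ, (n : ℝ) ≤ dist x (h n • x)) :
    ClustersAtInfinity (hyperfilter ℕ : Filter ℕ) x (fun n => h n • x) := by
  intro r
  obtain ⟨F, hF, N, hN⟩ := hc.exists_finite_cover hS hc0 (r : ℝ)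
  have h1 : ∀ᶠ n in (hyperfilter ℕ : Filter ℕ), ∃ w ∈ F, (r : ℝ) ≤ gromovProduct x (h n • x) w := by
    refine hyperfilter_le_cofinite ?_
    rw [Nat.cofinite_eq_atTop]
    filter_upwards [eventually_ge_atTop ⌈N⌉₊] with n hn
    exact hN _ (hh n) ((Nat.ceil_le.1 hn).trans (hd n))
  -- An ultrafilter selects one of finitely many classes.
  obtain ⟨w, -, hw⟩ := (Ultrafilter.eventually_exists_mem_iff hF).1 h1
  exact ⟨w, hw⟩

/-- Orbits with disjoint limit sets have bounded mutual Gromov products. -/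
theorem exists_gromovProduct_le_of_disjoint_limitSet [IsGeodesicSpace X] [IsGromovHyperbolic X]
    {H H' : Subgroup G} {x : X} {S : Set H} {S' : Set H'} {c c' : ℝ}
    (hS : IsFiniteGeneratingSet S) (hS' : IsFiniteGeneratingSet S') (hc0 : 0 ≤ c) (hc0' : 0 ≤ c')
    (hc : OrbitQIBound S x c) (hc' : OrbitQIBound S' x c')
    (hΛ : limitSet x H ∩ limitSet x H' = ∅) :
    ∃ C : ℝ, ∀ h ∈ H, ∀ g ∈ H', gromovProduct x (h • x) (g • x) ≤ C := by
  by_contra! hcon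
  choose h hh g hg hlt using fun n : ℕ => hcon n
  obtain ⟨δ, hδ0, hδ⟩ := exists_fourPoint X
  obtain ⟨φ, hφ, hu, hv⟩ := hδ.exists_subseq_convergesToInfinity hyperfilter_le_cofinite
    (hc.clustersAtInfinity hS hc0 hh fun n : ℕ => (hlt n).le.trans (gromovProduct_le_dist_left _ _ _))
    (hc'.clustersAtInfinity hS' hc0' hg
      fun n : ℕ => (hlt n).le.trans (gromovProduct_le_dist_right _ _ _))
  -- The products along `φ` exceed `φ n ≥ n`, so both subsequences define the same boundary point.
  have hmem : Quotient.mk (boundarySetoid X) ⟨_, hu⟩ ∈ limitSet x H ∩ limitSet x H' := by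
    refine ⟨⟨h ∘ φ, fun n => hh _, hu, rfl⟩, ⟨g ∘ φ, fun n => hg _, hv, Quotient.sound ?_⟩⟩
    intro o
    rw [tendsto_atTop]
    intro B
    filter_upwards [eventually_ge_atTop ⌈B + dist x o⌉₊] with n hn
    have h1 := hlt (φ n)
    have h2 : B + dist x o ≤ φ n := Nat.ceil_le.1 (hn.trans (hφ n))
    have h3 := gromovProduct_le_add_dist x o (h (φ n) • x) (g (φ n) • x)
    change B ≤ gromovProduct o (g (φ n) • x) (h (φ n) • x)
    rw [gromovProduct_comm]
    linarith
  rw [hΛ] at hmem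
  exact hmem

end LimitSet

/-! ### Counting elements of small displacement -/

section Movers

variable {G X : Type*} [Group G] [MetricSpace X] [MulAction G X]

/-- The elements that move each of `y` and `z` by at most `ε`. -/
def movers (G : Type*) {X : Type*} [Group G] [MetricSpace X] [MulAction G X] (ε : ℝ) (y z : X) :
    Set G :=
  {g | dist (g • y) y ≤ ε ∧ dist (g • z) z ≤ ε}

theorem encard_le_card_mul_of_fibers {α β : Type*} {A : Set α} {f : α → β} {B : Finset β}
    (hf : ∀ a ∈ A, f a ∈ B) {M : ℕ} (hM : ∀ b, {a | a ∈ A ∧ f a = b}.encard ≤ (M : ℕ∞)) :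
    A.encard ≤ ((B.card * M : ℕ) : ℕ∞) := by
  calc A.encard ≤ (⋃ b ∈ B, {a | a ∈ A ∧ f a = b}).encard :=
        Set.encard_le_encard fun a ha => Set.mem_biUnion (hf a ha) ⟨ha, rfl⟩
    _ ≤ ∑ b ∈ B, {a | a ∈ A ∧ f a = b}.encard := B.set_encard_biUnion_le _
    _ ≤ ∑ _b ∈ B, (M : ℕ∞) := Finset.sum_le_sum fun b _ => hM b
    _ = _ := by simp

variable [IsIsometricSMul G X]

theorem encard_movers_smul_le (g : G) (ε : ℝ) (y z : X) :
    (movers G ε (g • y) (g • z)).encard ≤ (movers G ε y z).encard := by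
  refine Set.encard_le_encard_of_injOn (f := fun h => g⁻¹ * h * g) ?_ ?_
  · rintro h ⟨h1, h2⟩
    constructor
    · rw [mul_smul, mul_smul, ← dist_smul g, smul_inv_smul]
      exact h1
    · rw [mul_smul, mul_smul, ← dist_smul g, smul_inv_smul]
      exact h2
  · intro a _ b _ hab
    simpa using hab

/-- The number of elements moving the ends `y`, `z` little is controlled by the number of elements
that move two intermediate points little, with a bound on the displacement independent of `ε`. -/
theorem FourPoint.encard_movers_le {δ C ε : ℝ} (hδ : FourPoint X δ) (hδ0 : 0 ≤ δ) {p p' y z : X}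
    (hp : gromovProduct p y z ≤ C) (hp' : gromovProduct p' y z ≤ C)
    (hpy : C + 2 * δ + ε < dist p y) (hpz : C + 2 * δ + ε < dist p z)
    (hpy' : C + 2 * δ + ε < dist p' y) (hpz' : C + 2 * δ + ε < dist p' z) {M : ℕ}
    (hM : (movers G (2 * C + 6 * δ + 1) p p').encard ≤ (M : ℕ∞)) :
    (movers G ε y z).encard ≤
      (((Finset.Icc ⌊-ε⌋ ⌊ε⌋ ×ˢ Finset.Icc ⌊-ε⌋ ⌊ε⌋).card * M : ℕ) : ℕ∞) := by
  have hshift : ∀ q : X, ∀ g ∈ movers G ε y z,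
      ⌊dist (g • q) y - dist q y⌋ ∈ Finset.Icc ⌊-ε⌋ ⌊ε⌋ := by
    rintro q g ⟨hg, -⟩
    have h1 := dist_triangle (g • q) (g • y) y
    have h2 := dist_triangle (g • q) y (g • y)
    rw [dist_comm y] at h2
    rw [dist_smul] at h1 h2
    exact Finset.mem_Icc.2 ⟨Int.floor_mono (by linarith), Int.floor_mono (by linarith)⟩
  have hclose : ∀ q : X, gromovProduct q y z ≤ C → C + 2 * δ + ε < dist q y →
      C + 2 * δ + ε < dist q z → ∀ g ∈ movers G ε y z, ∀ g' ∈ movers G ε y z,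
      ⌊dist (g • q) y - dist q y⌋ = ⌊dist (g' • q) y - dist q y⌋ →
      dist ((g'⁻¹ * g) • q) q ≤ 2 * C + 6 * δ + 1 := by
    intro q hq hqy hqz g hg g' hg' hfl
    have h1 := Int.abs_sub_lt_one_of_floor_eq_floor hfl
    rw [sub_sub_sub_cancel_right] at h1
    have h2 := hδ.dist_le_of_shift (hδ.gromovProduct_smul_le hq hg.1 hg.2 hqy hqz hδ0)
      (hδ.gromovProduct_smul_le hq hg'.1 hg'.2 hqy hqz hδ0) h1.le
    rw [mul_smul, ← dist_smul g', smul_inv_smul]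
    linarith
  -- Classes are given by the shifts of `p` and `p'` relative to `y`, rounded to integers. Within a
  -- class, dividing by a fixed `g₀` lands in the movers of `p`, `p'`.
  refine encard_le_card_mul_of_fibers
    (f := fun g => (⌊dist (g • p) y - dist p y⌋, ⌊dist (g • p') y - dist p' y⌋))
    (fun g hg => Finset.mk_mem_product (hshift p g hg) (hshift p' g hg)) fun b => ?_
  rcases Set.eq_empty_or_nonempty
    {a | a ∈ movers G ε y z ∧ (⌊dist (a • p) y - dist p y⌋, ⌊dist (a • p') y - dist p' y⌋) = b}
    with he | ⟨g₀, hg₀, hg₀b⟩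
  · rw [he]
    simp
  · refine le_trans (Set.encard_le_encard_of_injOn (f := fun g => g₀⁻¹ * g) ?_ ?_) hM
    · rintro g ⟨hg, hgb⟩
      obtain ⟨e1, e2⟩ := Prod.ext_iff.1 (hgb.trans hg₀b.symm)
      exact ⟨hclose p hp hpy hpz g hg g₀ hg₀ e1, hclose p' hp' hpy' hpz' g hg g₀ hg₀ e2⟩
    · intro a _ b _ hab
      simpa using hab

end Movers

/-! ### Reduced words as broken paths -/

section ReducedWords

variable {G X : Type*} [Group G] [MetricSpace X] [MulAction G X] {ι : Type*} {K : ι → Subgroup G}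

/-- The product in `G` of the first `m` letters of a word. -/
def prefixProd (l : List (Σ i, K i)) (m : ℕ) : G :=
  ((l.take m).map fun s => (s.2 : G)).prod

theorem prefixProd_zero (l : List (Σ i, K i)) : prefixProd l 0 = 1 := by
  simp [prefixProd]

theorem prefixProd_succ (l : List (Σ i, K i)) {m : ℕ} (hm : m < l.length) :
    prefixProd l (m + 1) = prefixProd l m * ((l[m]).2 : G) := by
  simp only [prefixProd]
  rw [← List.take_concat_get' l m hm, List.map_append, List.prod_append]
  simp

theorem prefixProd_length (w : Monoid.CoprodI.Word fun i => K i) :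
    prefixProd w.toList w.toList.length =
      Monoid.CoprodI.lift (fun i => (K i).subtype) w.prod := by
  simp [prefixProd, Monoid.CoprodI.Word.prod, map_list_prod, Function.comp_def]

theorem range_lift_subtype :
    (Monoid.CoprodI.lift fun i => (K i).subtype).range = ⨆ i, K i := by
  simp [Monoid.CoprodI.range_eq_iSup]

theorem exists_word_of_mem_iSup {g : G} (hg : g ∈ ⨆ i, K i) :
    ∃ w : Monoid.CoprodI.Word fun i => K i, prefixProd w.toList w.toList.length = g := by
  classical
  rw [← range_lift_subtype] at hg
  obtain ⟨y, rfl⟩ := hg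
  refine ⟨Monoid.CoprodI.Word.equiv y, ?_⟩
  rw [prefixProd_length]
  congr 1
  exact Monoid.CoprodI.Word.equiv.symm_apply_apply y

theorem prefixProd_mem_iSup (l : List (Σ i, K i)) (m : ℕ) : prefixProd l m ∈ ⨆ i, K i := by
  refine Subgroup.list_prod_mem _ fun g hg => ?_
  obtain ⟨s, -, rfl⟩ := List.mem_map.1 hg
  exact (le_iSup K s.1) s.2.2

/-- Nontrivial elements of the subgroups `K i` move `x` by more than `L`, and the orbits of `x`
under distinct `K i` have Gromov products at most `C`. -/
structure IsSeparated (K : ι → Subgroup G) (x : X) (C L : ℝ) : Prop where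
  gromovProduct_le : ∀ i j, i ≠ j → ∀ h ∈ K i, ∀ g ∈ K j, gromovProduct x (h • x) (g • x) ≤ C
  lt_dist : ∀ i, ∀ h ∈ K i, h ≠ 1 → L < dist x (h • x)

variable [IsIsometricSMul G X] {x : X} {δ C L : ℝ}

theorem dist_prefixProd_succ (l : List (Σ i, K i)) (x : X) {m : ℕ} (hm : m < l.length) :
    dist (prefixProd l m • x) (prefixProd l (m + 1) • x) = dist x (((l[m]).2 : G) • x) := by
  rw [dist_smul_smul_right, prefixProd_succ l hm, inv_mul_cancel_left]

variable (w : Monoid.CoprodI.Word fun i => K i)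

/-- Translated to `x`, the corner lies between the inverse of one letter and the next letter, which
come from different factors. -/
theorem IsSeparated.corner_le (h : IsSeparated K x C L) (m : ℕ) (hm : m + 2 ≤ w.toList.length) :
    gromovProduct (prefixProd w.toList (m + 1) • x) (prefixProd w.toList m • x)
      (prefixProd w.toList (m + 2) • x) ≤ C := by
  have h1 := prefixProd_succ w.toList (m := m) (by omega)
  have h2 := prefixProd_succ w.toList (m := m + 1) (by omega)
  have h3 : prefixProd w.toList m =
      prefixProd w.toList (m + 1) * ((w.toList[m]).2 : G)⁻¹ := by rw [h1, mul_inv_cancel_right]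
  rw [h3, h2, mul_smul, mul_smul, gromovProduct_smul]
  exact h.gromovProduct_le _ _ (List.isChain_iff_getElem.1 w.chain_ne m (by omega)) _
    (inv_mem (w.toList[m]).2.2) _ (w.toList[m + 1]).2.2

theorem letter_ne_one {m : ℕ} (hm : m < w.toList.length) : ((w.toList[m]).2 : G) ≠ 1 := by
  have := w.ne_one _ (List.getElem_mem hm)
  simpa using this

theorem IsSeparated.lt_dist_prefixProd (h : IsSeparated K x C L) (m : ℕ)
    (hm : m < w.toList.length) :
    L < dist (prefixProd w.toList m • x) (prefixProd w.toList (m + 1) • x) := by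
  rw [dist_prefixProd_succ _ _ hm]
  exact h.lt_dist _ _ (w.toList[m]).2.2 (letter_ne_one w hm)

theorem IsSeparated.dist_add_half_dist_le (h : IsSeparated K x C L) (hδ0 : 0 ≤ δ)
    (hδ : FourPoint X δ) (hC : 0 ≤ C) (hL : 4 * C + 4 * δ ≤ L) (m : ℕ)
    (hm : m < w.toList.length) :
    dist x (prefixProd w.toList m • x) +
      dist (prefixProd w.toList m • x) (prefixProd w.toList (m + 1) • x) / 2 ≤
      dist x (prefixProd w.toList (m + 1) • x) := by
  have := hδ.dist_add_half_dist_le (p := fun m => prefixProd w.toList m • x) hδ0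
    (h.corner_le w) hC (fun i hi => hL.trans_lt (h.lt_dist_prefixProd w i hi)) m hm
  simpa [prefixProd_zero] using this

theorem IsSeparated.gromovProduct_prefixProd_le (h : IsSeparated K x C L) (hδ0 : 0 ≤ δ)
    (hδ : FourPoint X δ) (hC : 0 ≤ C) (hL : 4 * C + 4 * δ ≤ L) (m : ℕ)
    (hm : m ≤ w.toList.length) :
    gromovProduct (prefixProd w.toList m • x) x (prefixProd w.toList w.toList.length • x) ≤
      C + 2 * δ := by
  have := hδ.gromovProduct_ends_le (p := fun m => prefixProd w.toList m • x) hδ0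
    (h.corner_le w) hC (fun i hi => by linarith [h.lt_dist_prefixProd w i hi]) m hm
  simpa [prefixProd_zero] using this

theorem IsSeparated.mul_half_le_dist (h : IsSeparated K x C L) (hδ0 : 0 ≤ δ)
    (hδ : FourPoint X δ) (hC : 0 ≤ C) (hL : 4 * C + 4 * δ ≤ L) (m : ℕ)
    (hm : m ≤ w.toList.length) : m * (L / 2) ≤ dist x (prefixProd w.toList m • x) := by
  induction m with
  | zero => simp
  | succ m ih =>
    have h1 := ih (by omega)
    have h2 := h.dist_add_half_dist_le w hδ0 hδ hC hL m hm
    have h3 := h.lt_dist_prefixProd w m hm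
    push_cast
    linarith

theorem IsSeparated.lift_injective (h : IsSeparated K x C L) (hδ0 : 0 ≤ δ)
    (hδ : FourPoint X δ) (hC : 0 ≤ C) (hL : 4 * C + 4 * δ ≤ L) (hL0 : 0 < L) :
    Function.Injective (Monoid.CoprodI.lift fun i => (K i).subtype) := by
  classical
  rw [injective_iff_map_eq_one]
  intro y hy
  obtain ⟨w, rfl⟩ := Monoid.CoprodI.Word.equiv.symm.surjective y
  change Monoid.CoprodI.lift _ w.prod = 1 at hy
  have h1 := h.mul_half_le_dist w hδ0 hδ hC hL _ le_rfl
  rw [prefixProd_length, hy, one_smul, dist_self] at h1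
  have h2 : w.toList = [] := by
    by_contra hne
    have : (0 : ℝ) < w.toList.length := by exact_mod_cast List.length_pos_of_ne_nil hne
    have := mul_pos this (half_pos hL0)
    linarith
  have h3 : w = Monoid.CoprodI.Word.empty := Monoid.CoprodI.Word.ext h2
  rw [h3]
  exact Monoid.CoprodI.Word.prod_empty

theorem IsSeparated.exists_mulEquiv (h : IsSeparated K x C L) (hδ0 : 0 ≤ δ)
    (hδ : FourPoint X δ) (hC : 0 ≤ C) (hL : 4 * C + 4 * δ ≤ L) (hL0 : 0 < L) :
    ∃ e : Monoid.CoprodI (fun i => K i) ≃* (⨆ i, K i : Subgroup G),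
      ∀ (i : ι) (a : K i), ((e (Monoid.CoprodI.of a) : (⨆ i, K i : Subgroup G)) : G) = a := by
  refine ⟨(MonoidHom.ofInjective (h.lift_injective hδ0 hδ hC hL hL0)).trans
    (MulEquiv.subgroupCongr range_lift_subtype), fun i a => ?_⟩
  change ((MonoidHom.ofInjective (h.lift_injective hδ0 hδ hC hL hL0) (Monoid.CoprodI.of a) :
    (Monoid.CoprodI.lift fun i => (K i).subtype).range) : G) = a
  rw [MonoidHom.ofInjective_apply, Monoid.CoprodI.lift_of, Subgroup.subtype_apply]

theorem exists_word_length {i j : ι} (hij : i ≠ j) (hi : K i ≠ ⊥) (hj : K j ≠ ⊥) (n : ℕ) :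
    ∃ w : Monoid.CoprodI.Word fun i => K i, w.toList.length = n := by
  obtain ⟨a, ha⟩ := Subgroup.ne_bot_iff_exists_ne_one.1 hi
  obtain ⟨b, hb⟩ := Subgroup.ne_bot_iff_exists_ne_one.1 hj
  induction n with
  | zero => exact ⟨Monoid.CoprodI.Word.empty, rfl⟩
  | succ n ih =>
    obtain ⟨w, hw⟩ := ih
    by_cases hfst : w.fstIdx = some i
    · refine ⟨Monoid.CoprodI.Word.cons b w ?_ hb, by simp [Monoid.CoprodI.Word.cons, hw]⟩
      rw [hfst]
      simpa using hij
    · exact ⟨Monoid.CoprodI.Word.cons a w hfst ha, by simp [Monoid.CoprodI.Word.cons, hw]⟩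

theorem IsSeparated.infinite_iSup (h : IsSeparated K x C L) (hδ0 : 0 ≤ δ)
    (hδ : FourPoint X δ) (hC : 0 ≤ C) (hL : 4 * C + 4 * δ ≤ L) (hL0 : 0 < L)
    (hK : (∃ i, Infinite (K i)) ∨ ∃ i j, i ≠ j ∧ K i ≠ ⊥ ∧ K j ≠ ⊥) :
    Infinite (⨆ i, K i : Subgroup G) := by
  rcases hK with ⟨i, hi⟩ | ⟨i, j, hij, hi, hj⟩
  · exact Infinite.of_injective _ (Subgroup.inclusion_injective (le_iSup K i))
  · by_contra hfin
    rw [not_infinite_iff_finite] at hfin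
    obtain ⟨B, hB⟩ := (Set.finite_range
      fun g : (⨆ i, K i : Subgroup G) => dist x ((g : G) • x)).bddAbove
    obtain ⟨n, hn⟩ := exists_nat_gt (B / (L / 2))
    rw [div_lt_iff₀ (half_pos hL0)] at hn
    obtain ⟨w, hw⟩ := exists_word_length hij hi hj n
    have h1 := h.mul_half_le_dist w hδ0 hδ hC hL _ le_rfl
    have h2 := hB ⟨⟨_, prefixProd_mem_iSup w.toList w.toList.length⟩, rfl⟩
    simp only at h2
    rw [hw] at h1 h2
    linarith

/-- The union of generating sets of the `K i`, as a subset of the group they generate. -/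
def unionGenerators (S : ∀ i, Set (K i)) : Set (⨆ i, K i : Subgroup G) :=
  ⋃ i, Subgroup.inclusion (le_iSup K i) '' S i

theorem isFiniteGeneratingSet_unionGenerators [Finite ι] {S : ∀ i, Set (K i)}
    (hS : ∀ i, IsFiniteGeneratingSet (S i)) : IsFiniteGeneratingSet (unionGenerators S) := by
  refine ⟨Set.finite_iUnion fun i => (hS i).1.image _, ?_⟩
  apply Subgroup.map_injective (⨆ i, K i).subtype_injective
  refine le_antisymm (Subgroup.map_mono le_top) ?_
  rw [← MonoidHom.range_eq_map, Subgroup.range_subtype]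
  refine iSup_le fun i => ?_
  have h1 : K i = (Subgroup.closure (S i)).map (K i).subtype := by
    rw [(hS i).2, ← MonoidHom.range_eq_map, Subgroup.range_subtype]
  rw [h1, MonoidHom.map_closure, MonoidHom.map_closure]
  refine Subgroup.closure_mono ?_
  rintro _ ⟨s, hs, rfl⟩
  exact ⟨Subgroup.inclusion (le_iSup K i) s, Set.mem_iUnion.2 ⟨i, s, hs, rfl⟩, rfl⟩

theorem IsSeparated.isQIEmbeddedByAction_iSup [Finite ι] (h : IsSeparated K x C L) (hδ0 : 0 ≤ δ)
    (hδ : FourPoint X δ) (hC : 0 ≤ C) (hL : 4 * C + 4 * δ ≤ L) (hL1 : 1 ≤ L)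
    {S : ∀ i, Set (K i)} (hS : ∀ i, IsFiniteGeneratingSet (S i)) {c : ℝ} (hc0 : 0 ≤ c)
    (hc : ∀ i, OrbitQIBound (S i) x c) : IsQIEmbeddedByAction X (⨆ i, K i : Subgroup G) := by
  have hT := isFiniteGeneratingSet_unionGenerators hS
  -- A letter of displacement `d > L ≥ 1` has length at most `c * (d + 1) ≤ 2 * c * d`, and it adds
  -- at least `d / 2` to the distance from `x`; hence the factor `4 * c`.
  have key : ∀ (w : Monoid.CoprodI.Word fun i => K i) (m : ℕ), m ≤ w.toList.length →
      (wordLength (unionGenerators S) ⟨_, prefixProd_mem_iSup w.toList m⟩ : ℝ) ≤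
        4 * c * dist x (prefixProd w.toList m • x) := by
    intro w m
    induction m with
    | zero =>
      intro _
      have : (⟨_, prefixProd_mem_iSup w.toList 0⟩ : (⨆ i, K i : Subgroup G)) = 1 :=
        Subtype.ext (prefixProd_zero w.toList)
      rw [this, wordLength_one, Nat.cast_zero]
      positivity
    | succ m ih =>
      intro hm
      set a := w.toList[m]
      have h1 : (⟨_, prefixProd_mem_iSup w.toList (m + 1)⟩ : (⨆ i, K i : Subgroup G)) =
          ⟨_, prefixProd_mem_iSup w.toList m⟩ * Subgroup.inclusion (le_iSup K a.1) a.2 :=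
        Subtype.ext (prefixProd_succ w.toList hm)
      have h2 : (wordLength (unionGenerators S) ⟨_, prefixProd_mem_iSup w.toList (m + 1)⟩ : ℝ) ≤
          wordLength (unionGenerators S) ⟨_, prefixProd_mem_iSup w.toList m⟩ +
            wordLength (S a.1) a.2 := by
        rw [h1]
        have e1 := wordLength_mul_le hT.2 ⟨_, prefixProd_mem_iSup w.toList m⟩
          (Subgroup.inclusion (le_iSup K a.1) a.2)
        have e2 := wordLength_map_le (T := unionGenerators S) (hS a.1).2
          (Subgroup.inclusion (le_iSup K a.1))
          (fun s hs => Set.mem_iUnion.2 ⟨a.1, s, hs, rfl⟩) a.2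
        exact_mod_cast e1.trans (Nat.add_le_add_left e2 _)
      have h3 := ih (by omega)
      have h4 := h.dist_add_half_dist_le w hδ0 hδ hC hL m hm
      have h5 := h.lt_dist_prefixProd w m hm
      have h6 := (hc a.1 a.2).1
      rw [← dist_prefixProd_succ w.toList x hm] at h6
      have h7 := mul_le_mul_of_nonneg_left h4 hc0
      have h8 := mul_le_mul_of_nonneg_left (hL1.trans h5.le) hc0
      linarith
  obtain ⟨c', -, hc'⟩ := exists_orbitQIBound hT x (c := 4 * c) fun a => by
    obtain ⟨w, hw⟩ := exists_word_of_mem_iSup a.2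
    have h1 := key w _ le_rfl
    have h2 : (⟨_, prefixProd_mem_iSup w.toList w.toList.length⟩ : (⨆ i, K i : Subgroup G)) = a :=
      Subtype.ext hw
    rw [h2, hw] at h1
    linarith
  exact hc'.isQIEmbeddedByAction hT

/-- `M₀` concerns a displacement free of `ε` and applies to every nontrivial letter; `M₁` depends on
`ε` and applies to letters of displacement at least `R₁` only. -/
theorem IsSeparated.exists_encard_movers_le (h : IsSeparated K x C L) (hδ0 : 0 ≤ δ)
    (hδ : FourPoint X δ) (hC : 0 ≤ C) (hL : 4 * C + 4 * δ ≤ L) {M₀ : ℕ}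
    (hM₀ : ∀ i, ∀ a ∈ K i, a ≠ 1 →
      (movers G (2 * C + 10 * δ + 1) x (a • x)).encard ≤ (M₀ : ℕ∞)) {ε R₁ : ℝ} {M₁ : ℕ}
    (hε : 0 ≤ ε) (hR₁ : 0 ≤ R₁) (hM₁ : ∀ i, ∀ a ∈ K i, R₁ ≤ dist x (a • x) →
      (movers G (2 * C + ε + 6 * δ) x (a • x)).encard ≤ (M₁ : ℕ∞)) :
    ∃ R : ℝ, 0 < R ∧ ∃ M : ℕ, 0 < M ∧ ∀ g ∈ ⨆ i, K i, R ≤ dist x (g • x) →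
      (movers G ε x (g • x)).encard ≤ (M : ℕ∞) := by
  -- `Q` exceeds the distance from both ends that `FourPoint.encard_movers_le` requires, with `C + 2
  -- * δ` for its `C`.
  set Q := C + 4 * δ + ε + 1
  have hQ0 : 0 < Q := by positivity
  refine ⟨2 * Q + 3 * R₁, by positivity,
    max M₁ ((Finset.Icc ⌊-ε⌋ ⌊ε⌋ ×ˢ Finset.Icc ⌊-ε⌋ ⌊ε⌋).card * M₀) + 1, by omega, ?_⟩
  intro g hg hR
  obtain ⟨w, rfl⟩ := exists_word_of_mem_iSup hg
  set n := w.toList.length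
  set p : ℕ → X := fun m => prefixProd w.toList m • x with hp
  have hp0 : p 0 = x := by simp [hp, prefixProd_zero]
  have hgp : ∀ m ≤ n, gromovProduct (p m) x (p n) ≤ C + 2 * δ := fun m hm =>
    h.gromovProduct_prefixProd_le w hδ0 hδ hC hL m hm
  have hadj : ∀ (m : ℕ) (hm : m < n) (ε' : ℝ), (movers G ε' (p m) (p (m + 1))).encard ≤
      (movers G ε' x (((w.toList[m]).2 : G) • x)).encard := by
    intro m hm ε'
    simp only [hp]
    rw [prefixProd_succ w.toList hm, mul_smul]
    exact encard_movers_smul_le _ _ _ _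
  change (movers G ε x (p n)).encard ≤ _
  change _ ≤ dist x (p n) at hR
  by_cases hlong : ∃ m, ∃ hm : m < n, R₁ ≤ dist x (((w.toList[m]).2 : G) • x)
  · obtain ⟨m, hm, hmR⟩ := hlong
    have h1 : movers G ε x (p n) ⊆ movers G (2 * C + ε + 6 * δ) (p m) (p (m + 1)) := by
      rintro a ⟨h1, h2⟩
      have e1 := hδ.dist_smul_le (hgp m hm.le) h1 h2
      have e2 := hδ.dist_smul_le (hgp (m + 1) hm) h1 h2
      exact ⟨by linarith, by linarith⟩
    refine (Set.encard_le_encard h1).trans ((hadj m hm _).trans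
      ((hM₁ _ _ (w.toList[m]).2.2 hmR).trans ?_))
    exact_mod_cast (le_max_left _ _).trans (Nat.le_succ _)
  · push Not at hlong
    have hstep : ∀ m < n, dist (p m) (p (m + 1)) < R₁ := fun m hm => by
      simp only [hp]
      rw [dist_prefixProd_succ _ _ hm]
      exact hlong m hm
    have hex : ∃ m, Q ≤ dist x (p m) := ⟨n, by linarith⟩
    classical
    -- The edge after the first vertex at distance at least `Q` from `x`. As edges are shorter than
    -- `R₁`, it ends within `Q + 2 * R₁` of `x`, so `R = 2 * Q + 3 * R₁` leaves more than `Q` to the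
    -- far end.
    obtain ⟨m, hmQ, hmin⟩ : ∃ m, Q ≤ dist x (p m) ∧ ∀ m' < m, dist x (p m') < Q :=
      ⟨Nat.find hex, Nat.find_spec hex, fun m' hm' => not_le.1 (Nat.find_min hex hm')⟩
    have hmn : m ≤ n := by
      by_contra! hlt
      linarith [hmin n hlt]
    have hmub : dist x (p m) < Q + R₁ := by
      rcases m with _ | m
      · rw [hp0, dist_self] at hmQ
        linarith
      · have := dist_triangle x (p m) (p (m + 1))
        linarith [hmin m (Nat.lt_succ_self m), hstep m hmn]
    have hmn' : m < n := by
      refine lt_of_le_of_ne hmn ?_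
      rintro rfl
      linarith
    have h1 := h.dist_add_half_dist_le w hδ0 hδ hC hL m hmn'
    change dist x (p m) + dist (p m) (p (m + 1)) / 2 ≤ dist x (p (m + 1)) at h1
    have h2 := hstep m hmn'
    have h3 := dist_triangle x (p m) (p n)
    have h4 := dist_triangle4 x (p m) (p (m + 1)) (p n)
    have h5 : 0 ≤ dist (p m) (p (m + 1)) := dist_nonneg
    have h6 : (movers G (2 * (C + 2 * δ) + 6 * δ + 1) (p m) (p (m + 1))).encard ≤ (M₀ : ℕ∞) := by
      rw [show 2 * (C + 2 * δ) + 6 * δ + 1 = 2 * C + 10 * δ + 1 by ring]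
      exact (hadj m hmn' _).trans (hM₀ _ _ (w.toList[m]).2.2 (letter_ne_one w hmn'))
    refine (hδ.encard_movers_le hδ0 (hgp m hmn) (hgp (m + 1) hmn') ?_ ?_ ?_ ?_ h6).trans ?_
    · rw [dist_comm]
      linarith
    · linarith
    · rw [dist_comm]
      linarith
    · linarith
    · exact_mod_cast (le_max_right _ _).trans (Nat.le_succ _)

end ReducedWords

theorem isAcylindricalAlong_of_movers {G X : Type*} [Group G] [MetricSpace X] [MulAction G X]
    [IsIsometricSMul G X] {K : Subgroup G} (x : X)
    (h : ∀ ε : ℝ, 0 ≤ ε → ∃ R : ℝ, 0 < R ∧ ∃ M : ℕ, 0 < M ∧ ∀ g ∈ K, R ≤ dist x (g • x) →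
      (movers G ε x (g • x)).encard ≤ (M : ℕ∞)) : IsAcylindricalAlong X K := by
  refine ⟨x, fun ε hε => ?_⟩
  obtain ⟨R, hR, M, hM, hRM⟩ := h ε hε
  refine ⟨R, hR, M, hM, ?_⟩
  rintro _ ⟨a, ha, rfl⟩ _ ⟨b, hb, rfl⟩ hd
  rw [dist_smul_smul_right] at hd
  have h1 := encard_movers_smul_le a ε x ((a⁻¹ * b) • x)
  rw [smul_smul, mul_inv_cancel_left] at h1
  exact h1.trans (hRM _ (mul_mem (inv_mem ha) hb) hd)

end AQI

/-! ### Choice of constants and the theorem -/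

theorem theorem1p2 {G X : Type*} [Group G] [MetricSpace X] [AQI.IsGeodesicSpace X]
    [AQI.IsGromovHyperbolic X] [MulAction G X] [IsIsometricSMul G X] (x : X)
    (k : ℕ) (H : Fin k → Subgroup G)
    (hH : ∀ i, AQI.IsAQITriple G X (H i))
    (hΛ : ∀ i j, i ≠ j → AQI.limitSet x (H i) ∩ AQI.limitSet x (H j) = ∅) :
    ∃ S : Set G, S.Finite ∧ S ⊆ (⋃ i, (H i : Set G)) ∧ 1 ∉ S ∧
      ∀ (K : Fin k → Subgroup G) (hKH : ∀ i, K i ≤ H i),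
        (∀ i, AQI.IsQIEmbeddedSubgroup (hKH i)) →
        (∀ i, (K i : Set G) ∩ S = ∅) →
        -- the subgroup generated by the `K i` is their free product, via the canonical map
        (∃ e : Monoid.CoprodI (fun i => K i) ≃* (⨆ i, K i : Subgroup G),
          ∀ (i : Fin k) (a : K i), ((e (Monoid.CoprodI.of a) : (⨆ i, K i : Subgroup G)) : G) = a) ∧
        -- unless the `K i` are all trivial, except for at most one, which is finite
        ((∃ i, Infinite (K i)) ∨ (∃ i j, i ≠ j ∧ K i ≠ ⊥ ∧ K j ≠ ⊥) →
          AQI.IsAQITriple G X (⨆ i, K i)) := by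
  obtain ⟨δ, hδ0, hδ⟩ := AQI.exists_fourPoint X
  choose T hT using fun i => (hH i).qiEmbedded
  choose c hc0 hc using fun i => (hH i).qiEmbedded.exists_bound (hT i).1 x
  have hC' : ∀ i j, ∃ C : ℝ, i ≠ j →
      ∀ h ∈ H i, ∀ g ∈ H j, AQI.gromovProduct x (h • x) (g • x) ≤ C := by
    intro i j
    by_cases hij : i = j
    · exact ⟨0, fun h => absurd hij h⟩
    · obtain ⟨C, hC⟩ := AQI.exists_gromovProduct_le_of_disjoint_limitSet (hT i).1 (hT j).1 (hc0 i)
        (hc0 j) (hc i) (hc j) (hΛ i j hij)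
      exact ⟨C, fun _ => hC⟩
  choose C' hC' using hC'
  obtain ⟨C₀, hC₀⟩ := (Set.finite_range fun q : Fin k × Fin k => C' q.1 q.2).bddAbove
  set C := max C₀ 0
  have hC0 : 0 ≤ C := le_max_right _ _
  have hC : ∀ i j, i ≠ j → ∀ h ∈ H i, ∀ g ∈ H j, AQI.gromovProduct x (h • x) (g • x) ≤ C :=
    fun i j hij h hh g hg =>
      (hC' i j hij h hh g hg).trans ((hC₀ ⟨(i, j), rfl⟩).trans (le_max_left _ _))
  have hacyl : ∀ i, AQI.IsAcylindricalAlong X (H i) := fun i => (hH i).acylindrical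
  obtain ⟨R₀, hR₀, M₀, hM₀⟩ := AQI.exists_uniform_acylindrical_bound hacyl x
    (by positivity : 0 ≤ 2 * C + 10 * δ + 1)
  -- `4 * C + 4 * δ` is for the broken paths, `1` for the word length estimate, and `R₀` for
  -- acylindricity at the displacement free of `ε`. Nothing here depends on `K` or `ε`.
  set L := 4 * C + 4 * δ + 1 + R₀ with hL
  refine ⟨⋃ i, {h : G | h ∈ H i ∧ dist x (h • x) < L + 1} \ {1},
    Set.finite_iUnion fun i => ((hc i).finite_dist_lt (hT i).1 (hc0 i) _).sdiff,
    Set.iUnion_mono fun i h hh => hh.1.1, by simp, ?_⟩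
  intro K hKH hK hKS
  have hsep : AQI.IsSeparated K x C L :=
    { gromovProduct_le := fun i j hij h hh g hg => hC i j hij h (hKH i hh) g (hKH j hg)
      lt_dist := fun i h hh h1 => by
        by_contra! hle
        have hmem : h ∈ (K i : Set G) ∩ ⋃ i, {h : G | h ∈ H i ∧ dist x (h • x) < L + 1} \ {1} :=
          ⟨hh, Set.mem_iUnion.2 ⟨i, ⟨hKH i hh, by linarith⟩, h1⟩⟩
        rw [hKS i] at hmem
        exact hmem }
  have hL4 : 4 * C + 4 * δ ≤ L := by linarith
  have hL1 : 1 ≤ L := by linarith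
  refine ⟨hsep.exists_mulEquiv hδ0.le hδ hC0 hL4 (by linarith), fun hinf => ?_⟩
  refine ⟨hsep.infinite_iSup hδ0.le hδ hC0 hL4 (by linarith) hinf, ?_, ?_⟩
  · choose S hS b hb0 hb using fun i => (hK i).exists_bound (hH i).qiEmbedded x
    obtain ⟨b₀, hb₀⟩ := (Set.finite_range b).bddAbove
    refine hsep.isQIEmbeddedByAction_iSup hδ0.le hδ hC0 hL4 hL1 hS (le_max_right b₀ 0)
      fun i => (hb i).mono ((hb₀ ⟨i, rfl⟩).trans (le_max_left _ _))
  · refine AQI.isAcylindricalAlong_of_movers x fun ε hε => ?_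
    obtain ⟨R₁, hR₁, M₁, hM₁⟩ := AQI.exists_uniform_acylindrical_bound hacyl x
      (by positivity : 0 ≤ 2 * C + ε + 6 * δ)
    exact hsep.exists_encard_movers_le hδ0.le hδ hC0 hL4
      (fun i a ha h1 => hM₀ i a (hKH i ha) (by linarith [hsep.lt_dist i a ha h1])) hε hR₁
      fun i a ha hd => hM₁ i a (hKH i ha) hd
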